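/- Let $n\ge 1$. For $j\in\mathbb Z$, $m\in\mathbb Z^n$ let $Q_{j,m}=\prod_{i=1}^n[2^{-j}m_i,2^{-j}(m_i+1))$, and let $q'$ denote the conjugate exponent of $q\in[1,\infty]$. Let ${}^*X$ be a real Banach space and let $X=({}^*X)^*$ be its dual (up to isometric isomorphism), with duality pairing $\langle\cdot,\cdot\rangle$. Assume that ${}^*X$ is reflexive or that $X$ is separable. Let $1<p<t<r<\infty$ or $1<p\le t<r=\infty$. Functions are strongly measurable and identified when they agree almost everywhere. The Bourgain–Morrey space $M_p^{t,r}(X)$ consists of all $f\in L^p_{\mathrm{loc}}(\mathbb R^n;X)$ with $$\|f\|_{M_p^{t,r}(X)}=\Big\|\Big\{|Q_{j,m}|^{1/t-1/p}\Big(\int_{Q_{j,m}}\|f(x)\|_X^p\,dx\Big)^{1/p}\Big\}_{(j,m)\in\mathbb Z^{1+n}}\Big\|_{\ell^r}<\infty .$$ A $(p',t',{}^*X)$-block supported on a cube $Q$ is a function $b:\mathbb R^n\to{}^*X$ vanishing outside $Q$ with $\|b\|_{L^{p'}({}^*X)}\le|Q|^{1/t-1/p}=|Q|^{1/p'-1/t'}$.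 The block space $\mathcal H_{p'}^{t',r'}({}^*X)$ consists of all $g:\mathbb R^n\to{}^*X$ that can be written as $$g=\sum_{(j,m)\in\mathbb Z^{1+n}}\lambda_{j,m}b_{j,m}\quad\text{a.e. (the sum converging unconditionally in }{}^*X\text{ a.e.)},$$ with $\lambda\in\ell^{r'}(\mathbb Z^{1+n})$ real and $b_{j,m}$ a $(p',t',{}^*X)$-block supported on $Q_{j,m}$; its norm $\|g\|_{\mathcal H_{p'}^{t',r'}({}^*X)}$ is the infimum of $\|\lambda\|_{\ell^{r'}}$ over all such representations. Then the dual space of $\mathcal H_{p'}^{t',r'}({}^*X)$ is $M_p^{t,r}(X)$, in the following sense. (i) If $f\in M_p^{t,r}(X)$, then for every $g\in\mathcal H_{p'}^{t',r'}({}^*X)$ the function $x\mapsto\langle g(x),f(x)\rangle$ is integrable, and $J_f(g):=\int_{\mathbb R^n}\langle g(x),f(x)\rangle\,dx$ defines a bounded linear functional on $\mathcal H_{p'}^{t',r'}({}^*X)$. (ii) Conversely, every continuous linear functional on $\mathcal H_{p'}^{t',r'}({}^*X)$ equals $J_f$ for a unique $f\in M_p^{t,r}(X)$. Moreover, $\|f\|_{M_p^{t,r}(X)}=\|J_f\|_{(\mathcal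 H_{p'}^{t',r'}({}^*X))^*}$ for all $f\in M_p^{t,r}(X)$, and for every $g\in\mathcal H_{p'}^{t',r'}({}^*X)$ $$\|g\|_{\mathcal H_{p'}^{t',r'}({}^*X)}=\max\Big\{\Big|\int_{\mathbb R^n}\langle g(x),f(x)\rangle\,dx\Big|:f\in M_p^{t,r}(X),\ \|f\|_{M_p^{t,r}(X)}\le1\Big\},$$ the maximum being attained. -/

import Mathlib

open MeasureTheory
open scoped ENNReal

noncomputable section

namespace BourgainMorrey

/-- A real Banach space `E` is reflexive if its canonical embedding into its bidual is onto. -/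
def IsReflexiveSpace (E : Type*) [NormedAddCommGroup E] [NormedSpace ℝ E] : Prop :=
  Function.Surjective (NormedSpace.inclusionInDoubleDual ℝ E)

/-- The index set `ℤ × ℤⁿ` of the dyadic cubes. -/
abbrev DyadicIndex (n : ℕ) : Type := ℤ × (Fin n → ℤ)

/-- The dyadic cube `Q_{j,m} = ∏ᵢ [2^{-j} mᵢ, 2^{-j} (mᵢ + 1))`. -/
def dyadicCube {n : ℕ} (q : DyadicIndex n) : Set (EuclideanSpace ℝ (Fin n)) :=
  {x | ∀ i, (2 : ℝ) ^ (-q.1) * (q.2 i : ℝ) ≤ x i ∧ x i < (2 : ℝ) ^ (-q.1) * ((q.2 i : ℝ) + 1)}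

/-- The `ℓ^r` norm of a (real or `[0,∞]`-valued) family over the dyadic cubes. -/
abbrev ellNorm {n : ℕ} {ε : Type*} [TopologicalSpace ε] [ContinuousENorm ε]
    (a : DyadicIndex n → ε) (r : ℝ≥0∞) : ℝ≥0∞ :=
  eLpNorm a r Measure.count

/-! ### Bourgain–Morrey spaces -/

section Morrey

variable {n : ℕ} {X : Type*} [NormedAddCommGroup X]

/-- `f ∈ L^p_loc(X)`. -/
def MemLpLoc (p : ℝ≥0∞) (f : EuclideanSpace ℝ (Fin n) → X) : Prop :=
  AEStronglyMeasurable f volume ∧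
    ∀ K : Set (EuclideanSpace ℝ (Fin n)), IsCompact K → MemLp f p (volume.restrict K)

/-- The quantity `|Q|^{1/t-1/p} (∫_Q ‖f‖^p)^{1/p}` for a dyadic cube `Q`. -/
def morreyTerm (p t : ℝ≥0∞) (f : EuclideanSpace ℝ (Fin n) → X) (q : DyadicIndex n) : ℝ≥0∞ :=
  volume (dyadicCube q) ^ ((t⁻¹).toReal - (p⁻¹).toReal) *
    eLpNorm f p (volume.restrict (dyadicCube q))

/-- The Bourgain–Morrey norm, with values in `[0,∞]`. -/
def morreyENorm (p t r : ℝ≥0∞) (f : EuclideanSpace ℝ (Fin n) → X) : ℝ≥0∞ :=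
  ellNorm (morreyTerm p t f) r

theorem morreyENorm_congr {p t r : ℝ≥0∞} {f g : EuclideanSpace ℝ (Fin n) → X}
    (h : f =ᵐ[volume] g) : morreyENorm p t r f = morreyENorm p t r g := by
  unfold morreyENorm
  congr 1
  funext q
  unfold morreyTerm
  rw [eLpNorm_congr_ae (ae_restrict_of_ae h)]

theorem MemLpLoc.congr {p : ℝ≥0∞} {f g : EuclideanSpace ℝ (Fin n) → X}
    (hf : MemLpLoc p f) (h : f =ᵐ[volume] g) : MemLpLoc p g :=
  ⟨hf.1.congr h, fun K hK => (memLp_congr_ae (ae_restrict_of_ae h)).1 (hf.2 K hK)⟩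

theorem morreyENorm_add_le {p t r : ℝ≥0∞} (hp : 1 ≤ p) (hr : 1 ≤ r)
    {f g : EuclideanSpace ℝ (Fin n) → X} (hf : AEStronglyMeasurable f volume)
    (hg : AEStronglyMeasurable g volume) :
    morreyENorm p t r (f + g) ≤ morreyENorm p t r f + morreyENorm p t r g := by
  unfold morreyENorm
  refine le_trans ?_ (eLpNorm_add_le (by fun_prop) (by fun_prop) hr)
  refine eLpNorm_mono_enorm fun q => ?_
  simp only [enorm_eq_self, Pi.add_apply, morreyTerm, ← mul_add]
  gcongr
  exact eLpNorm_add_le hf.restrict hg.restrict hp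

theorem morreyENorm_smul_le [NormedSpace ℝ X] {p t r : ℝ≥0∞} (c : ℝ)
    (f : EuclideanSpace ℝ (Fin n) → X) :
    morreyENorm p t r (c • f) ≤ ‖c‖ₑ * morreyENorm p t r f := by
  unfold morreyENorm
  have h : morreyTerm p t (c • f) = ‖c‖₊ • morreyTerm p t f := by
    funext q
    simp only [morreyTerm, eLpNorm_const_smul, Pi.smul_apply, ENNReal.smul_def, smul_eq_mul,
      enorm_eq_nnnorm]
    ring
  rw [h]
  refine (eLpNorm_le_nnreal_smul_eLpNorm_of_ae_le_mul' (c := ‖c‖₊) (g := morreyTerm p t f)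
    (Filter.Eventually.of_forall fun q => ?_) r).trans ?_
  · simp [ENNReal.smul_def]
  · simp [ENNReal.smul_def, enorm_eq_nnnorm]

variable (n X)

/-- The `X`-valued Bourgain–Morrey space `M_p^{t,r}(X)` on `ℝⁿ`, a space of almost-everywhere
classes of strongly measurable functions. -/
def MorreySpace [NormedSpace ℝ X] (p t r : ℝ≥0∞) [Fact (1 ≤ p)] [Fact (1 ≤ r)] :
    Submodule ℝ (EuclideanSpace ℝ (Fin n) →ₘ[volume] X) where
  carrier := {f | MemLpLoc p f ∧ morreyENorm p t r f < ∞}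
  add_mem' := by
    rintro f g ⟨hf, hf'⟩ ⟨hg, hg'⟩
    refine ⟨MemLpLoc.congr (f := ⇑f + ⇑g) ⟨hf.1.add hg.1, fun K hK => (hf.2 K hK).add (hg.2 K hK)⟩
      (AEEqFun.coeFn_add f g).symm, ?_⟩
    rw [morreyENorm_congr (AEEqFun.coeFn_add f g)]
    exact (morreyENorm_add_le Fact.out Fact.out hf.1 hg.1).trans_lt
      (ENNReal.add_lt_top.2 ⟨hf', hg'⟩)
  zero_mem' := by
    have h0 : ⇑(0 : EuclideanSpace ℝ (Fin n) →ₘ[volume] X) =ᵐ[volume]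
        (0 : EuclideanSpace ℝ (Fin n) → X) :=
      AEEqFun.coeFn_zero
    refine ⟨MemLpLoc.congr (f := 0) ⟨aestronglyMeasurable_zero, fun K _ => MemLp.zero⟩ h0.symm, ?_⟩
    rw [morreyENorm_congr h0]
    have : morreyTerm p t (0 : EuclideanSpace ℝ (Fin n) → X) = 0 := by
      funext q
      simp [morreyTerm]
    simp [morreyENorm, this]
  smul_mem' := by
    rintro c f ⟨hf, hf'⟩
    refine ⟨MemLpLoc.congr (f := c • ⇑f) ⟨hf.1.const_smul c, fun K hK => (hf.2 K hK).const_smul c⟩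
      (AEEqFun.coeFn_smul c f).symm, ?_⟩
    rw [morreyENorm_congr (AEEqFun.coeFn_smul c f)]
    exact (morreyENorm_smul_le c _).trans_lt (ENNReal.mul_lt_top enorm_lt_top hf')

variable {n X}

/-- The Bourgain–Morrey norm as a seminorm on the (real) vector space `M_p^{t,r}(X)`. -/
def morreySeminorm [NormedSpace ℝ X] (p t r : ℝ≥0∞) [Fact (1 ≤ p)] [Fact (1 ≤ r)] :
    Seminorm ℝ (MorreySpace n X p t r) :=
  Seminorm.ofSMulLE (fun f => (morreyENorm p t r (f : EuclideanSpace ℝ (Fin n) → X)).toReal)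
    (by
      have h0 := (MorreySpace n X p t r).zero_mem
      have := morreyENorm_smul_le (p := p) (t := t) (r := r) 0
        ⇑(0 : EuclideanSpace ℝ (Fin n) →ₘ[volume] X)
      rw [← morreyENorm_congr (AEEqFun.coeFn_smul (0 : ℝ) _), zero_smul, enorm_zero, zero_mul] at this
      simp [le_antisymm this bot_le])
    (fun f g => by
      rw [← ENNReal.toReal_add f.2.2.ne g.2.2.ne]
      refine ENNReal.toReal_mono (ENNReal.add_lt_top.2 ⟨f.2.2, g.2.2⟩).ne ?_
      rw [Submodule.coe_add, morreyENorm_congr (AEEqFun.coeFn_add _ _)]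
      exact morreyENorm_add_le Fact.out Fact.out f.2.1.1 g.2.1.1)
    (fun c f => by
      rw [← toReal_enorm, ← ENNReal.toReal_mul]
      refine ENNReal.toReal_mono (ENNReal.mul_lt_top enorm_lt_top f.2.2).ne ?_
      rw [Submodule.coe_smul, morreyENorm_congr (AEEqFun.coeFn_smul _ _)]
      exact morreyENorm_smul_le c _)

instance [NormedSpace ℝ X] (p t r : ℝ≥0∞) [Fact (1 ≤ p)] [Fact (1 ≤ r)] :
    SeminormedAddCommGroup (MorreySpace n X p t r) :=
  (morreySeminorm p t r).toAddGroupSeminorm.toSeminormedAddCommGroup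

theorem MorreySpace.norm_def [NormedSpace ℝ X] {p t r : ℝ≥0∞} [Fact (1 ≤ p)] [Fact (1 ≤ r)]
    (f : MorreySpace n X p t r) :
    ‖f‖ = (morreyENorm p t r (f : EuclideanSpace ℝ (Fin n) → X)).toReal := rfl

instance [NormedSpace ℝ X] (p t r : ℝ≥0∞) [Fact (1 ≤ p)] [Fact (1 ≤ r)] :
    NormedSpace ℝ (MorreySpace n X p t r) where
  norm_smul_le c f := (map_smul_eq_mul (morreySeminorm p t r) c f).le

end Morrey

/-! ### Block spaces -/

section Block

variable {n : ℕ} {E : Type*} [NormedAddCommGroup E]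

/-- `b` is an `(s, u, E)`-block supported on `Q`: it vanishes off `Q` and
`‖b‖_{L^s(E)} ≤ |Q|^{1/s - 1/u}`. -/
structure IsBlock (s u : ℝ≥0∞) (Q : Set (EuclideanSpace ℝ (Fin n)))
    (b : EuclideanSpace ℝ (Fin n) → E) : Prop where
  aestronglyMeasurable : AEStronglyMeasurable b volume
  support : ∀ᵐ x ∂volume, x ∉ Q → b x = 0
  eLpNorm_le : eLpNorm b s volume ≤ volume Q ^ ((s⁻¹).toReal - (u⁻¹).toReal)

theorem IsBlock.zero (s u : ℝ≥0∞) (Q : Set (EuclideanSpace ℝ (Fin n))) :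
    IsBlock s u Q (0 : EuclideanSpace ℝ (Fin n) → E) :=
  ⟨aestronglyMeasurable_zero, by simp, by simp⟩

variable [NormedSpace ℝ E]

/-- The family `lam` is admissible for `g`: `lam ∈ ℓ^w` and `g = ∑ lam_q b_q` almost everywhere
for some `(s, u, E)`-blocks `b_q` supported on the dyadic cubes `Q_q`. -/
def IsAdmissible (s u w : ℝ≥0∞) (g : EuclideanSpace ℝ (Fin n) → E) (lam : DyadicIndex n → ℝ) :
    Prop :=
  ellNorm lam w < ∞ ∧
    ∃ b : DyadicIndex n → EuclideanSpace ℝ (Fin n) → E,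
      (∀ q, IsBlock s u (dyadicCube q) (b q)) ∧
      ∀ᵐ x ∂volume, HasSum (fun q => lam q • b q x) (g x)

/-- The block norm, with values in `[0,∞]` (the infimum of the empty set being `∞`). -/
def blockENorm (s u w : ℝ≥0∞) (g : EuclideanSpace ℝ (Fin n) → E) : ℝ≥0∞ :=
  ⨅ (lam : DyadicIndex n → ℝ) (_ : IsAdmissible s u w g lam), ellNorm lam w

/-- A combination `a b + a' b'` of blocks is `|a| + |a'|` times a block. -/
theorem IsBlock.exists_combination {s u : ℝ≥0∞} (hs : 1 ≤ s)
    {Q : Set (EuclideanSpace ℝ (Fin n))} {b b' : EuclideanSpace ℝ (Fin n) → E}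
    (hb : IsBlock s u Q b) (hb' : IsBlock s u Q b') (a a' : ℝ) :
    ∃ d : EuclideanSpace ℝ (Fin n) → E, IsBlock s u Q d ∧
      ∀ x, (|a| + |a'|) • d x = a • b x + a' • b' x := by
  by_cases h0 : |a| + |a'| = 0
  · have ha : a = 0 := abs_eq_zero.1 (by linarith [abs_nonneg a, abs_nonneg a'])
    have ha' : a' = 0 := abs_eq_zero.1 (by linarith [abs_nonneg a, abs_nonneg a'])
    exact ⟨0, IsBlock.zero s u Q, by simp [ha, ha']⟩
  · have hpos : 0 < |a| + |a'| := lt_of_le_of_ne (by positivity) (Ne.symm h0)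
    refine ⟨(|a| + |a'|)⁻¹ • (a • b + a' • b'), ⟨?_, ?_, ?_⟩, fun x => ?_⟩
    · exact ((hb.1.const_smul a).add (hb'.1.const_smul a')).const_smul _
    · filter_upwards [hb.2, hb'.2] with x h h' hx
      simp [h hx, h' hx]
    · rw [eLpNorm_const_smul]
      have h1 : eLpNorm (a • b + a' • b') s volume ≤
          (‖a‖ₑ + ‖a'‖ₑ) * volume Q ^ ((s⁻¹).toReal - (u⁻¹).toReal) := by
        refine (eLpNorm_add_le (hb.1.const_smul a) (hb'.1.const_smul a') hs).trans ?_
        rw [eLpNorm_const_smul, eLpNorm_const_smul, add_mul]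
        gcongr
        · exact hb.3
        · exact hb'.3
      have h2 : ‖(|a| + |a'|)⁻¹‖ₑ * (‖a‖ₑ + ‖a'‖ₑ) = 1 := by
        rw [← ofReal_norm, ← ofReal_norm, ← ofReal_norm,
          ← ENNReal.ofReal_add (norm_nonneg _) (norm_nonneg _),
          ← ENNReal.ofReal_mul (norm_nonneg _), Real.norm_eq_abs, Real.norm_eq_abs,
          Real.norm_eq_abs, abs_of_pos (inv_pos.2 hpos), inv_mul_cancel₀ h0, ENNReal.ofReal_one]
      calc _ ≤ ‖(|a| + |a'|)⁻¹‖ₑ *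
            ((‖a‖ₑ + ‖a'‖ₑ) * volume Q ^ ((s⁻¹).toReal - (u⁻¹).toReal)) := by gcongr
        _ = _ := by rw [← mul_assoc, h2, one_mul]
    · simp only [Pi.smul_apply, Pi.add_apply, smul_smul, mul_inv_cancel₀ h0, one_smul]

theorem IsAdmissible.congr {s u w : ℝ≥0∞} {g g' : EuclideanSpace ℝ (Fin n) → E}
    {lam : DyadicIndex n → ℝ} (h : IsAdmissible s u w g lam) (hg : g =ᵐ[volume] g') :
    IsAdmissible s u w g' lam := by
  obtain ⟨h1, b, hb, hs⟩ := h
  refine ⟨h1, b, hb, ?_⟩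
  filter_upwards [hs, hg] with x hx hx'
  rwa [← hx']

theorem blockENorm_congr {s u w : ℝ≥0∞} {g g' : EuclideanSpace ℝ (Fin n) → E}
    (hg : g =ᵐ[volume] g') : blockENorm s u w g = blockENorm s u w g' := by
  unfold blockENorm
  have : ∀ lam, IsAdmissible s u w g lam ↔ IsAdmissible s u w g' lam :=
    fun lam => ⟨fun h => h.congr hg, fun h => h.congr hg.symm⟩
  simp only [this]

theorem blockENorm_lt_top_iff {s u w : ℝ≥0∞} {g : EuclideanSpace ℝ (Fin n) → E} :
    blockENorm s u w g < ∞ ↔ ∃ lam, IsAdmissible s u w g lam := by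
  constructor
  · intro h
    by_contra! hc
    simp [blockENorm, hc] at h
  · rintro ⟨lam, h⟩
    exact (iInf₂_le lam h).trans_lt h.1

theorem IsAdmissible.zero (s u w : ℝ≥0∞) :
    IsAdmissible s u w (0 : EuclideanSpace ℝ (Fin n) → E) 0 :=
  ⟨by simp, 0, fun q => IsBlock.zero s u _, by simp [hasSum_zero]⟩

theorem IsAdmissible.add {s u w : ℝ≥0∞} (hs : 1 ≤ s) (hw : 1 ≤ w)
    {g g' : EuclideanSpace ℝ (Fin n) → E} {lam lam' : DyadicIndex n → ℝ}
    (h : IsAdmissible s u w g lam) (h' : IsAdmissible s u w g' lam') :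
    ∃ nu, IsAdmissible s u w (g + g') nu ∧ ellNorm nu w ≤ ellNorm lam w + ellNorm lam' w := by
  obtain ⟨h1, b, hb, hsum⟩ := h
  obtain ⟨h1', b', hb', hsum'⟩ := h'
  choose d hd hdeq using fun q => (hb q).exists_combination hs (hb' q) (lam q) (lam' q)
  have hle : ellNorm (fun q => |lam q| + |lam' q|) w ≤ ellNorm lam w + ellNorm lam' w := by
    have := eLpNorm_add_le (f := fun q => ‖lam q‖) (g := fun q => ‖lam' q‖)
      (μ := Measure.count) (p := w) (by fun_prop) (by fun_prop) hw
    rwa [eLpNorm_norm, eLpNorm_norm] at this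
  refine ⟨_, ⟨hle.trans_lt (ENNReal.add_lt_top.2 ⟨h1, h1'⟩), d, hd, ?_⟩, hle⟩
  filter_upwards [hsum, hsum'] with x hx hx'
  simp only [hdeq, Pi.add_apply]
  exact hx.add hx'

theorem IsAdmissible.smul {s u w : ℝ≥0∞} {g : EuclideanSpace ℝ (Fin n) → E}
    {lam : DyadicIndex n → ℝ} (h : IsAdmissible s u w g lam) (c : ℝ) :
    IsAdmissible s u w (c • g) (c • lam) := by
  obtain ⟨h1, b, hb, hsum⟩ := h
  refine ⟨?_, b, hb, ?_⟩
  · unfold ellNorm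
    rw [eLpNorm_const_smul]
    exact ENNReal.mul_lt_top enorm_lt_top h1
  · filter_upwards [hsum] with x hx
    simpa only [Pi.smul_apply, smul_eq_mul, mul_smul] using hx.const_smul c

theorem blockENorm_add_le {s u w : ℝ≥0∞} (hs : 1 ≤ s) (hw : 1 ≤ w)
    (g g' : EuclideanSpace ℝ (Fin n) → E) :
    blockENorm s u w (g + g') ≤ blockENorm s u w g + blockENorm s u w g' := by
  simp only [blockENorm, ENNReal.iInf_add, ENNReal.add_iInf]
  refine le_iInf₂ fun lam h => le_iInf₂ fun lam' h' => ?_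
  obtain ⟨nu, h1, h2⟩ := IsAdmissible.add hs hw h' h
  rw [add_comm (ellNorm lam' w)] at h2
  exact (iInf₂_le nu h1).trans (h2.trans (by rw [add_comm]))

theorem blockENorm_zero {s u w : ℝ≥0∞} :
    blockENorm s u w (0 : EuclideanSpace ℝ (Fin n) → E) = 0 := by
  refine le_antisymm ((iInf₂_le 0 (IsAdmissible.zero s u w)).trans ?_) bot_le
  simp

theorem blockENorm_smul_le {s u w : ℝ≥0∞} (c : ℝ) (g : EuclideanSpace ℝ (Fin n) → E) :
    blockENorm s u w (c • g) ≤ ‖c‖ₑ * blockENorm s u w g := by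
  by_cases hc : c = 0
  · simp [hc, blockENorm_zero]
  · rw [blockENorm, blockENorm, ENNReal.mul_iInf_of_ne (by simpa using hc) enorm_ne_top]
    refine le_iInf fun lam => ?_
    rw [ENNReal.mul_iInf_of_ne (by simpa using hc) enorm_ne_top]
    refine le_iInf fun h => (iInf₂_le _ (h.smul c)).trans ?_
    exact (eLpNorm_const_smul c lam w Measure.count).le

variable (n E)

/-- The `E`-valued block space `H_s^{u,w}(E)` on `ℝⁿ`, a space of almost-everywhere classes of
strongly measurable functions. -/
def BlockSpace (s u w : ℝ≥0∞) [Fact (1 ≤ s)] [Fact (1 ≤ w)] :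
    Submodule ℝ (EuclideanSpace ℝ (Fin n) →ₘ[volume] E) where
  carrier := {g | ∃ lam, IsAdmissible s u w g lam}
  add_mem' := by
    rintro g g' ⟨lam, h⟩ ⟨lam', h'⟩
    obtain ⟨nu, h1, -⟩ := h.add Fact.out Fact.out h'
    exact ⟨nu, h1.congr (AEEqFun.coeFn_add g g').symm⟩
  zero_mem' := ⟨0, (IsAdmissible.zero s u w).congr
    (AEEqFun.coeFn_zero (μ := (volume : Measure (EuclideanSpace ℝ (Fin n)))) (β := E)).symm⟩
  smul_mem' := by
    rintro c g ⟨lam, h⟩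
    exact ⟨_, (h.smul c).congr (AEEqFun.coeFn_smul c g).symm⟩

variable {n E}

theorem BlockSpace.blockENorm_ne_top {s u w : ℝ≥0∞} [Fact (1 ≤ s)] [Fact (1 ≤ w)]
    (g : BlockSpace n E s u w) : blockENorm s u w (g : EuclideanSpace ℝ (Fin n) → E) ≠ ∞ :=
  (blockENorm_lt_top_iff.2 g.2).ne

/-- The block norm as a seminorm on the (real) vector space `H_s^{u,w}(E)`. -/
def blockSeminorm (s u w : ℝ≥0∞) [Fact (1 ≤ s)] [Fact (1 ≤ w)] :
    Seminorm ℝ (BlockSpace n E s u w) :=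
  Seminorm.ofSMulLE (fun g => (blockENorm s u w (g : EuclideanSpace ℝ (Fin n) → E)).toReal)
    (by
      have h0 : ⇑(0 : EuclideanSpace ℝ (Fin n) →ₘ[volume] E) =ᵐ[volume]
          (0 : EuclideanSpace ℝ (Fin n) → E) :=
        AEEqFun.coeFn_zero
      simp [blockENorm_congr h0, blockENorm_zero])
    (fun f g => by
      rw [← ENNReal.toReal_add (BlockSpace.blockENorm_ne_top f) (BlockSpace.blockENorm_ne_top g)]
      refine ENNReal.toReal_mono
        (ENNReal.add_ne_top.2 ⟨(BlockSpace.blockENorm_ne_top f), (BlockSpace.blockENorm_ne_top g)⟩) ?_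
      rw [Submodule.coe_add, blockENorm_congr (AEEqFun.coeFn_add _ _)]
      exact blockENorm_add_le Fact.out Fact.out _ _)
    (fun c g => by
      rw [← toReal_enorm, ← ENNReal.toReal_mul]
      refine ENNReal.toReal_mono (ENNReal.mul_ne_top enorm_ne_top (BlockSpace.blockENorm_ne_top g)) ?_
      rw [Submodule.coe_smul, blockENorm_congr (AEEqFun.coeFn_smul _ _)]
      exact blockENorm_smul_le c _)

instance (s u w : ℝ≥0∞) [Fact (1 ≤ s)] [Fact (1 ≤ w)] :
    SeminormedAddCommGroup (BlockSpace n E s u w) :=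
  (blockSeminorm s u w).toAddGroupSeminorm.toSeminormedAddCommGroup

theorem BlockSpace.norm_def {s u w : ℝ≥0∞} [Fact (1 ≤ s)] [Fact (1 ≤ w)]
    (g : BlockSpace n E s u w) :
    ‖g‖ = (blockENorm s u w (g : EuclideanSpace ℝ (Fin n) → E)).toReal := rfl

instance (s u w : ℝ≥0∞) [Fact (1 ≤ s)] [Fact (1 ≤ w)] :
    NormedSpace ℝ (BlockSpace n E s u w) where
  norm_smul_le c g := (map_smul_eq_mul (blockSeminorm s u w) c g).le

end Block

instance fact_one_le_conjExponent (q : ℝ≥0∞) : Fact (1 ≤ ENNReal.conjExponent q) :=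
  ⟨le_self_add⟩

end BourgainMorrey

end

namespace BourgainMorrey

open Filter Topology
open scoped NNReal

/-! ### Scalar densities of functionals on `L^s(μ; E)` -/

section Density

variable {Ω E : Type*} [MeasurableSpace Ω] {μ : Measure Ω} [IsFiniteMeasure μ]
  [NormedAddCommGroup E] {s : ℝ≥0∞}

/-! Write `s`, `u`, `w` for the conjugates of `p`, `t`, `r`. Since `1/t - 1/p = 1/s - 1/u`, Hölder's
inequality on a cube bounds the pairing of `f` with a block by the corresponding entry of the Morrey
sequence of `f`, and Hölder for `ℓ^r` and `ℓ^w` sums these bounds over all cubes. Hence `f` acts on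
the block space with norm at most its Morrey norm (`lintegral_enorm_pairing_le`).

Conversely, let `L` be a functional. Extension by zero embeds `L^s(Q; E)` into the block space, so
`L` yields a functional on each `L^s(Q; E)`, represented by some `f_Q` in `L^p(Q; E*)`. On overlaps
the `f_Q` agree, because they have the same integrals against the functions `1_A e`, and they glue
to one `f`. Testing `L` on finite sums of almost norming functions of the cubes shows that the
Morrey norm of `f` is at most `‖L‖` (`sum_mul_norm_comp_cubeEmbedding_le`,
`ellNorm_le_of_forall_finset`). Since `w < ∞`, finite block sums are dense, so `L` is the pairing
with `f` (`dual_ext`). The formula for the block norm is then Hahn–Banach.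

The analytic core is the duality of `L^s(μ; E)` and `L^p(μ; E*)` for finite `μ`
(`exists_representing_function`); it is here that reflexivity or separability enters. Radon–Nikodym
gives densities `h_e` of `A ↦ T (1_A e)`. The operator `φ ↦ (e ↦ T (φ e))` on the separable space
`L^s(μ)` takes its values in a separable weak-* closed subspace `Y` of `E*`, normed by a sequence
`e_i` in the unit ball of `E`. The function `sup_i h_{e_i}⁺` has `L^p` norm at most `‖T‖`
(`eLpNorm_iSup_density_le`) and dominates the vector measure, so the averages of the latter over
small sets have weak-* limits `f(x)` at almost every `x`. Lebesgue differentiation identifies `f(x)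
e` with `h_e(x)`, and Pettis' argument in `Y` makes `f` strongly measurable. -/

theorem sum_indicatorConstLp {A : ℕ → Set Ω} (hA : ∀ i, MeasurableSet (A i))
    (hd : Pairwise (Function.onFun Disjoint A)) (e : E) (F : Finset ℕ) :
    ∑ i ∈ F, indicatorConstLp s (hA i) (measure_ne_top μ _) e =
      indicatorConstLp s (F.measurableSet_biUnion fun i _ => hA i) (measure_ne_top μ _) e := by
  induction F using Finset.induction_on with
  | empty => simp
  | insert a F ha ih =>
    have hdisj : Disjoint (A a) (⋃ i ∈ F, A i) := by
      rw [Set.disjoint_iUnion₂_right]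
      exact fun i hi => hd (fun h => ha (h ▸ hi))
    rw [Finset.sum_insert ha, ih, ← indicatorConstLp_disjoint_union (hA a)
      (F.measurableSet_biUnion fun i _ => hA i) (measure_ne_top μ _) (measure_ne_top μ _) hdisj]
    simp only [Finset.set_biUnion_insert]

variable [Fact (1 ≤ s)]

/-- Countable additivity of `A ↦ 1_A e` in `L^s`: for `s < ∞` it suffices that the measure of the
part not yet covered tends to zero, being bounded by the tail of a convergent series. -/
theorem hasSum_indicatorConstLp (hs : s ≠ ∞) {A : ℕ → Set Ω} (hA : ∀ i, MeasurableSet (A i))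
    (hd : Pairwise (Function.onFun Disjoint A)) (e : E) :
    HasSum (fun i => indicatorConstLp s (hA i) (measure_ne_top μ _) e)
      (indicatorConstLp s (MeasurableSet.iUnion hA) (measure_ne_top μ _) e) := by
  unfold HasSum
  simp only [SummationFilter.unconditional_filter, sum_indicatorConstLp hA hd]
  refine tendsto_indicatorConstLp_set hs ?_
  have hfin : ∑' i, μ (A i) ≠ ∞ := by
    rw [← measure_iUnion hd hA]
    exact measure_ne_top μ _
  refine tendsto_of_tendsto_of_tendsto_of_le_of_le tendsto_const_nhds
    (ENNReal.tendsto_tsum_compl_atTop_zero hfin) (fun _ => zero_le) fun F => ?_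
  refine (measure_mono (t := ⋃ i : {i // i ∉ F}, A i) ?_).trans (measure_iUnion_le _)
  rintro x (⟨hx, hx'⟩ | ⟨hx, hx'⟩)
  · obtain ⟨i, -, hi⟩ := Set.mem_iUnion₂.1 hx
    exact absurd (Set.mem_iUnion.2 ⟨i, hi⟩) hx'
  · obtain ⟨i, hi⟩ := Set.mem_iUnion.1 hx
    exact Set.mem_iUnion.2 ⟨⟨i, fun hF => hx' (Set.mem_iUnion₂.2 ⟨i, hF, hi⟩)⟩, hi⟩

variable [NormedSpace ℝ E]

open Classical in
/-- The signed measure `A ↦ T (1_A e)`. -/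
noncomputable def evalMeasure (hs : s ≠ ∞) (T : StrongDual ℝ (Lp E s μ)) (e : E) :
    SignedMeasure Ω where
  measureOf' A :=
    if hA : MeasurableSet A then T (indicatorConstLp s hA (measure_ne_top μ _) e) else 0
  empty' := by simp
  not_measurable' A hA := by simp [hA]
  m_iUnion' A hA hd := by
    simp only [hA, MeasurableSet.iUnion hA, dite_true]
    exact (hasSum_indicatorConstLp hs hA hd e).mapL T

/-- Radon–Nikodym for the signed measure `evalMeasure`, which is absolutely continuous because `1_A
e` vanishes in `L^s` when `A` is null. -/
theorem exists_scalar_density (hs : s ≠ ∞) (T : StrongDual ℝ (Lp E s μ)) (e : E) :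
    ∃ h : Ω → ℝ, Measurable h ∧ Integrable h μ ∧ ∀ (A : Set Ω) (hA : MeasurableSet A),
      T (indicatorConstLp s hA (measure_ne_top μ _) e) = ∫ x in A, h x ∂μ := by
  have hval : ∀ (A : Set Ω) (hA : MeasurableSet A), evalMeasure hs T e A =
      T (indicatorConstLp s hA (measure_ne_top μ _) e) := fun A hA => dif_pos hA
  have hac : evalMeasure hs T e ≪ᵥ μ.toENNRealVectorMeasure := by
    refine VectorMeasure.AbsolutelyContinuous.mk fun A hA hA0 => ?_
    rw [Measure.toENNRealVectorMeasure_apply_measurable hA] at hA0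
    rw [hval A hA]
    have : indicatorConstLp s hA (measure_ne_top μ _) e = 0 := by
      rw [← norm_eq_zero]
      refine le_antisymm (norm_indicatorConstLp_le.trans ?_) (norm_nonneg _)
      have : (1 / s.toReal) ≠ 0 := by
        have h1 : (1 : ℝ≥0∞) ≤ s := Fact.out
        have := (ENNReal.toReal_pos (by positivity) hs).ne'
        positivity
      simp only [measureReal_def, hA0, ENNReal.toReal_zero, Real.zero_rpow this, mul_zero, le_refl]
    rw [this, map_zero]
  refine ⟨(evalMeasure hs T e).rnDeriv μ, SignedMeasure.measurable_rnDeriv _ _,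
    SignedMeasure.integrable_rnDeriv _ _, fun A hA => ?_⟩
  rw [← hval A hA, ← withDensityᵥ_apply (SignedMeasure.integrable_rnDeriv _ _) hA,
    SignedMeasure.withDensityᵥ_rnDeriv_eq _ _ hac]

/-- The operator `φ ↦ (e ↦ T (φ e))` from `L^s(μ)` to `E*`. -/
noncomputable def toDualOperator (T : StrongDual ℝ (Lp E s μ)) :
    Lp ℝ s μ →L[ℝ] StrongDual ℝ E :=
  ((ContinuousLinearMap.compL ℝ E (Lp E ∞ μ) ℝ).flip (Lp.constL ∞ μ ℝ)) ∘L
    (ContinuousLinearMap.compL ℝ (Lp E ∞ μ) (Lp E s μ) ℝ T) ∘L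
      ((ContinuousLinearMap.lsmul ℝ ℝ).holderL μ s ∞ s)

theorem toDualOperator_indicator (T : StrongDual ℝ (Lp E s μ)) {A : Set Ω}
    (hA : MeasurableSet A) (e : E) :
    toDualOperator T (indicatorConstLp s hA (measure_ne_top μ _) 1) e =
      T (indicatorConstLp s hA (measure_ne_top μ _) e) := by
  change T ((ContinuousLinearMap.lsmul ℝ ℝ).holder s
    (indicatorConstLp s hA (measure_ne_top μ _) 1) (Lp.const ∞ μ e)) = _
  congr 1
  apply Lp.ext
  filter_upwards [(ContinuousLinearMap.lsmul ℝ ℝ).coeFn_holder (r := s)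
      (indicatorConstLp s hA (measure_ne_top μ _) (1 : ℝ)) (Lp.const ∞ μ e),
    indicatorConstLp_coeFn (p := s) (hs := hA) (hμs := measure_ne_top μ A) (c := (1 : ℝ)),
    indicatorConstLp_coeFn (p := s) (hs := hA) (hμs := measure_ne_top μ A) (c := e),
    Lp.coeFn_const (p := ∞) (μ := μ) e] with x h1 h2 h3 h4
  rw [h1, h2, h3, h4]
  by_cases hx : x ∈ A <;> simp [hx]

end Density

/-! ### Separable norming -/

section Norming

variable {E : Type*} [NormedAddCommGroup E] [NormedSpace ℝ E]

/-- A closed subspace of the dual of a reflexive space is weak-* closed. -/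
theorem mem_of_forall_eval_eq_zero (hE : IsReflexiveSpace E) {Y : Submodule ℝ (StrongDual ℝ E)}
    (hY : IsClosed (Y : Set (StrongDual ℝ E))) {y : StrongDual ℝ E}
    (h : ∀ e : E, (∀ z ∈ Y, z e = 0) → y e = 0) : y ∈ Y := by
  by_contra hy
  have hne : ‖Y.mkQL y‖ ≠ 0 := by
    intro h0
    apply hy
    have := (QuotientAddGroup.norm_mk_eq_zero_iff_mem_closure (S := Y.toAddSubgroup) (m := y)).1 h0
    rwa [Submodule.coe_toAddSubgroup, hY.closure_eq] at this
  -- Hahn–Banach in the quotient separates `y` from `Y` by an element of the bidual; reflexivity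
  -- realizes it as evaluation at a vector.
  obtain ⟨g, -, hg⟩ := exists_dual_vector ℝ (Y.mkQL y) hne
  obtain ⟨e, he⟩ := hE (g ∘L Y.mkQL)
  have hev : ∀ z : StrongDual ℝ E, z e = g (Y.mkQL z) := fun z => by
    have := congrArg (fun φ => φ z) he
    simpa using this
  apply hne
  have h0 := h e fun z hz => by
    rw [hev, show Y.mkQL z = 0 from (Submodule.Quotient.mk_eq_zero Y).2 hz, map_zero]
  rw [hev, hg] at h0
  exact_mod_cast h0

/-- A separable part of `E*` is normed by a sequence of the unit ball of `E`. -/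
theorem exists_norming_seq {Y : Set (StrongDual ℝ E)} (hY : TopologicalSpace.IsSeparable Y) :
    ∃ e : ℕ → E, (∀ i, ‖e i‖ ≤ 1) ∧
      ∀ y ∈ Y, ∀ c : ℝ, (∀ i, y (e i) ≤ c) → ‖y‖ ≤ c := by
  obtain ⟨D, hD, hYD⟩ := hY
  have key : ∀ (y : StrongDual ℝ E) (k : ℕ), ∃ e : E, ‖e‖ ≤ 1 ∧ ‖y‖ - 1 / (k + 1) ≤ y e := by
    intro y k
    obtain ⟨x, hx, hxy⟩ := y.exists_lt_apply_of_lt_opNorm (r := ‖y‖ - 1 / (k + 1))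
      (by have : (0 : ℝ) < 1 / (k + 1) := by positivity
          linarith)
    rcases le_total 0 (y x) with h | h
    · exact ⟨x, hx.le, by rw [Real.norm_of_nonneg h] at hxy; exact hxy.le⟩
    · exact ⟨-x, by rw [norm_neg]; exact hx.le, by
        rw [Real.norm_of_nonpos h] at hxy; rw [map_neg]; exact hxy.le⟩
  choose a ha1 ha2 using key
  -- Inserting `0` keeps the countable set nonempty, hence the range of a sequence, even if `D` is
  -- empty.
  have hc : (insert 0 ((fun z : StrongDual ℝ E × ℕ => a z.1 z.2) '' (D ×ˢ Set.univ))).Countable :=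
    ((hD.prod Set.countable_univ).image _).insert 0
  obtain ⟨b, hb⟩ := hc.exists_eq_range (Set.insert_nonempty _ _)
  refine ⟨b, fun i => ?_, fun y hy c hyc => ?_⟩
  · have : b i ∈ Set.range b := ⟨i, rfl⟩
    rw [← hb] at this
    rcases this with h | ⟨z, -, h⟩
    · simp [h]
    · rw [← h]
      exact ha1 _ _
  · have hyc' : ∀ z ∈ D, ∀ k, y (a z k) ≤ c := fun z hz k => by
      have : a z k ∈ Set.range b := by
        rw [← hb]
        exact Or.inr ⟨(z, k), ⟨hz, trivial⟩, rfl⟩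
      obtain ⟨i, hi⟩ := this
      rw [← hi]
      exact hyc i
    refine le_of_forall_pos_le_add fun ε hε => ?_
    obtain ⟨z, hz, hyz⟩ := Metric.mem_closure_iff.1 (hYD hy) (ε / 4) (by positivity)
    obtain ⟨k, hk⟩ := exists_nat_one_div_lt (show 0 < ε / 4 by positivity)
    rw [dist_eq_norm] at hyz
    have h1 := ha2 z k
    have h2 := hyc' z hz k
    have h3 : ‖(z - y) (a z k)‖ ≤ ‖z - y‖ * 1 :=
      (z - y).le_opNorm_of_le (ha1 z k)
    rw [norm_sub_rev, mul_one, Real.norm_eq_abs] at h3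
    have h4 := le_abs_self ((z - y) (a z k))
    rw [sub_apply] at h4 h3
    have h5 : ‖y‖ ≤ ‖z‖ + ‖y - z‖ := by
      simpa using norm_add_le z (y - z)
    linarith

end Norming

/-! ### Duality for `L^p` norms of nonnegative functions -/

section Duality

variable {Ω : Type*} [MeasurableSpace Ω] {μ : Measure Ω} [IsFiniteMeasure μ]

theorem lintegral_rpow_le_of_forall_simpleFunc {p s : ℝ} (hps : p.HolderConjugate s)
    {φ : Ω → ℝ≥0∞} {K : ℝ≥0∞}
    (h : ∀ ψ : SimpleFunc Ω ℝ≥0,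
      ∫⁻ x, ψ x * φ x ∂μ ≤ K * (∫⁻ x, (ψ x : ℝ≥0∞) ^ s ∂μ) ^ (1 / s)) :
    (∫⁻ x, φ x ^ p ∂μ) ^ (1 / p) ≤ K := by
  have hp := hps.pos
  have hs := hps.symm.pos
  have hsum : 1 / s + 1 / p = 1 := by
    rw [one_div, one_div]
    exact hps.symm.inv_add_inv_eq_one
  rw [one_div, ENNReal.rpow_inv_le_iff hp, lintegral_eq_nnreal]
  refine iSup₂_le fun χ hχ => ?_
  rw [← SimpleFunc.lintegral_eq_lintegral]
  simp only [SimpleFunc.map_apply]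
  set I := ∫⁻ x, (χ x : ℝ≥0∞) ∂μ with hI
  -- Finiteness of `I` is what allows the division by `I ^ (1 / s)` below.
  have hIfin : I ≠ ∞ := by
    obtain ⟨C, hC⟩ := χ.exists_forall_le
    refine ((lintegral_mono (g := fun _ => (C : ℝ≥0∞))
      fun x => ENNReal.coe_le_coe.2 (hC x)).trans_lt ?_).ne
    rw [lintegral_const]
    exact ENNReal.mul_lt_top ENNReal.coe_lt_top (measure_lt_top μ _)
  have h1 : I ≤ K * I ^ (1 / s) := by
    -- The extremal test function for Hölder: `χ = χ^{1/s} χ^{1/p} ≤ χ^{1/s} φ`, which leads to `I ≤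
    -- K I^{1/s}`.
    have h2 := h (χ.map fun c => c ^ (1 / s))
    simp only [SimpleFunc.map_apply] at h2
    have h3 : ∀ x, ((χ x ^ (1 / s) : ℝ≥0) : ℝ≥0∞) ^ s = χ x := fun x => by
      rw [← ENNReal.coe_rpow_of_nonneg _ hs.le, ← NNReal.rpow_mul, one_div_mul_cancel hs.ne',
        NNReal.rpow_one]
    simp only [h3] at h2
    refine le_trans (lintegral_mono fun x => ?_) h2
    have h4 : (χ x : ℝ≥0∞) ^ (1 / p) ≤ φ x := by
      rw [one_div, ENNReal.rpow_inv_le_iff hp]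
      exact hχ x
    calc (χ x : ℝ≥0∞) = (χ x : ℝ≥0∞) ^ (1 / s) * (χ x : ℝ≥0∞) ^ (1 / p) := by
          rw [← ENNReal.rpow_add_of_nonneg _ _ (by positivity) (by positivity), hsum,
            ENNReal.rpow_one]
      _ ≤ _ := by
          rw [ENNReal.coe_rpow_of_nonneg _ (by positivity)]
          gcongr
  by_cases hI0 : I = 0
  · rw [hI0]
    exact zero_le
  rw [← ENNReal.rpow_inv_le_iff hp, ← one_div]
  have h5 : I ^ (1 / s) ≠ 0 := by
    simp [hI0, hIfin]
  have h6 : I ^ (1 / s) ≠ ∞ := ENNReal.rpow_ne_top_of_nonneg (by positivity) hIfin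
  rw [← ENNReal.mul_le_mul_iff_left h5 h6, ← ENNReal.rpow_add_of_nonneg _ _ (by positivity)
    (by positivity), add_comm, hsum, ENNReal.rpow_one]
  exact h1

end Duality

/-! ### The `L^p` majorant of the scalar densities -/

section Majorant

variable {Ω E : Type*} [MeasurableSpace Ω] [NormedAddCommGroup E]

/-- The partial maxima of a sequence of densities are attained along simple functions. -/
theorem exists_simpleFunc_eq_iSup {h : E → Ω → ℝ} (hm : ∀ e, Measurable (h e)) (h0 : h 0 = 0)
    {e : ℕ → E} (he : ∀ i, ‖e i‖ ≤ 1) (N : ℕ) :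
    ∃ b : SimpleFunc Ω E, (∀ x, ‖b x‖ ≤ 1) ∧ (∀ x, 0 ≤ h (b x) x) ∧
      ∀ x, ENNReal.ofReal (h (b x) x) = ⨆ i < N, ENNReal.ofReal (h (e i) x) := by
  classical
  induction N with
  -- Starting from the vector `0`, whose density is identically zero, builds the positive part into
  -- the maximum.
  | zero => exact ⟨0, by simp, by simp [h0], by simp [h0]⟩
  | succ N ih =>
    obtain ⟨b, hb1, hb0, hb⟩ := ih
    have hA : MeasurableSet {x | h (b x) x < h (e N) x} :=
      measurableSet_lt (b.measurable_bind h hm) (hm (e N))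
    refine ⟨SimpleFunc.piecewise _ hA (SimpleFunc.const Ω (e N)) b, fun x => ?_, fun x => ?_,
      fun x => ?_⟩
    · by_cases hx : h (b x) x < h (e N) x <;> simp [hx, hb1, he]
    · by_cases hx : h (b x) x < h (e N) x
      · simpa [hx] using (hb0 x).trans hx.le
      · simp [hx, hb0]
    · rw [Nat.iSup_lt_succ, ← hb x]
      by_cases hx : h (b x) x < h (e N) x
      · simp [hx, ENNReal.ofReal_le_ofReal hx.le]
      · simp [hx, ENNReal.ofReal_le_ofReal (not_lt.1 hx)]

variable [NormedSpace ℝ E] {μ : Measure Ω} [IsFiniteMeasure μ] {s : ℝ≥0∞} [Fact (1 ≤ s)]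

/-- The scalar is kept apart from the vector because `e ↦ h e x` need not be linear at a given
point: the densities are determined only up to null sets depending on `e`. -/
theorem apply_simpleFunc_eq_integral {T : StrongDual ℝ (Lp E s μ)} {h : E → Ω → ℝ}
    (hint : ∀ e, Integrable (h e) μ)
    (hT : ∀ e (A : Set Ω) (hA : MeasurableSet A),
      T (indicatorConstLp s hA (measure_ne_top μ _) e) = ∫ x in A, h e x ∂μ)
    (F : SimpleFunc Ω (ℝ × E)) :
    Integrable (fun x => (F x).1 * h (F x).2 x) μ ∧
      ∃ hm : MemLp (fun x => (F x).1 • (F x).2) s μ,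
        T hm.toLp = ∫ x, (F x).1 * h (F x).2 x ∂μ := by
  classical
  induction F using SimpleFunc.induction with
  | const c hA =>
    rename_i A
    have e1 : (fun x => ((SimpleFunc.piecewise A hA (SimpleFunc.const Ω c)
        (SimpleFunc.const Ω 0)) x).1 • ((SimpleFunc.piecewise A hA (SimpleFunc.const Ω c)
        (SimpleFunc.const Ω 0)) x).2) = A.indicator fun _ => c.1 • c.2 := by
      funext x
      by_cases hx : x ∈ A <;> simp [hx]
    have e2 : (fun x => ((SimpleFunc.piecewise A hA (SimpleFunc.const Ω c)
        (SimpleFunc.const Ω 0)) x).1 * h ((SimpleFunc.piecewise A hA (SimpleFunc.const Ω c)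
        (SimpleFunc.const Ω 0)) x).2 x) = A.indicator fun x => c.1 * h c.2 x := by
      funext x
      by_cases hx : x ∈ A <;> simp [hx]
    rw [e1, e2]
    refine ⟨((hint c.2).const_mul c.1).indicator hA,
      memLp_indicator_const s hA _ (Or.inr (measure_ne_top μ _)), ?_⟩
    rw [integral_indicator hA, integral_const_mul, ← hT c.2 A hA, ← smul_eq_mul, ← map_smul]
    congr 1
    apply Lp.ext
    filter_upwards [MemLp.coeFn_toLp (memLp_indicator_const s hA (c.1 • c.2)
        (Or.inr (measure_ne_top μ A))),
      Lp.coeFn_smul c.1 (indicatorConstLp s hA (measure_ne_top μ _) c.2),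
      indicatorConstLp_coeFn (p := s) (hs := hA) (hμs := measure_ne_top μ A) (c := c.2)]
      with x h1 h2 h3
    rw [h1, h2, Pi.smul_apply, h3]
    by_cases hx : x ∈ A <;> simp [hx]
  | add hd hf hg =>
    rename_i f g
    obtain ⟨fi, fm, fT⟩ := hf
    obtain ⟨gi, gm, gT⟩ := hg
    have hor : ∀ x, f x = 0 ∨ g x = 0 := fun x => by
      by_contra! hne
      exact Set.disjoint_left.1 hd hne.1 hne.2
    have e1 : (fun x => ((f + g) x).1 • ((f + g) x).2) =
        (fun x => (f x).1 • (f x).2) + fun x => (g x).1 • (g x).2 := by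
      funext x
      rcases hor x with hx | hx <;> simp [hx]
    have e2 : (fun x => ((f + g) x).1 * h ((f + g) x).2 x) =
        (fun x => (f x).1 * h (f x).2 x) + fun x => (g x).1 * h (g x).2 x := by
      funext x
      rcases hor x with hx | hx <;> simp [hx]
    rw [e1, e2]
    refine ⟨fi.add gi, fm.add gm, ?_⟩
    rw [MemLp.toLp_add fm gm, map_add, fT, gT, integral_add' fi gi]

/-- Let a simple `b` with `‖b‖ ≤ 1` select the largest of finitely many densities. Then the integral
of `ψ` times this maximum equals `T (ψ b) ≤ ‖T‖ ‖ψ‖_s`, so duality and monotone convergence give the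
bound. -/
theorem eLpNorm_iSup_density_le {p : ℝ≥0∞} [p.HolderConjugate s] (hp' : p ≠ ∞) (hs : s ≠ ∞)
    {T : StrongDual ℝ (Lp E s μ)} {h : E → Ω → ℝ}
    (h0 : h 0 = 0) (hm : ∀ e, Measurable (h e)) (hint : ∀ e, Integrable (h e) μ)
    (hT : ∀ e (A : Set Ω) (hA : MeasurableSet A),
      T (indicatorConstLp s hA (measure_ne_top μ _) e) = ∫ x in A, h e x ∂μ)
    {e : ℕ → E} (he : ∀ i, ‖e i‖ ≤ 1) :
    eLpNorm (fun x => ⨆ i, ENNReal.ofReal (h (e i) x)) p μ ≤ ‖T‖ₑ := by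
  have hs1 : (1 : ℝ≥0∞) ≤ s := Fact.out
  have hps' : p.toReal.HolderConjugate s.toReal :=
    ENNReal.HolderConjugate.toReal_of_ne_top hp' hs
  have hp0 : p ≠ 0 := fun h => hps'.ne_zero (by simp [h])
  rw [eLpNorm_eq_lintegral_rpow_enorm_toReal hp0 hp']
  simp only [enorm_eq_self]
  refine lintegral_rpow_le_of_forall_simpleFunc hps' fun ψ => ?_
  have hmono : ∀ x, (ψ x : ℝ≥0∞) * ⨆ i, ENNReal.ofReal (h (e i) x) =
      ⨆ N : ℕ, (ψ x : ℝ≥0∞) * ⨆ i < N, ENNReal.ofReal (h (e i) x) := fun x => by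
    rw [← ENNReal.mul_iSup]
    congr 1
    refine le_antisymm (iSup_le fun i => ?_) (iSup_le fun N => iSup₂_le fun i _ =>
      le_iSup (fun i => ENNReal.ofReal (h (e i) x)) i)
    exact le_iSup_of_le (i + 1) (le_iSup₂_of_le i (Nat.lt_succ_self i) le_rfl)
  simp only [hmono]
  rw [lintegral_iSup]
  rotate_left
  · intro N
    refine Measurable.mul (ψ.measurable.coe_nnreal_ennreal) ?_
    exact .iSup fun i => .iSup fun _ => (hm _).ennreal_ofReal
  · intro N M hNM x
    exact mul_le_mul' le_rfl (biSup_mono fun i hi => lt_of_lt_of_le hi hNM)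
  refine iSup_le fun N => ?_
  obtain ⟨b, hb1, hb0, hb⟩ := exists_simpleFunc_eq_iSup hm h0 he N
  simp only [← hb]
  obtain ⟨hi, hL, hTi⟩ := apply_simpleFunc_eq_integral hint hT
    ((ψ.map ((↑) : ℝ≥0 → ℝ)).pair b)
  simp only [SimpleFunc.pair_apply, SimpleFunc.map_apply] at hi hL hTi
  have e1 : ∫⁻ x, ψ x * ENNReal.ofReal (h (b x) x) ∂μ = ENNReal.ofReal (T hL.toLp) := by
    rw [hTi, ofReal_integral_eq_lintegral_ofReal hi
      (Eventually.of_forall fun x => mul_nonneg (ψ x).2 (hb0 x))]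
    refine lintegral_congr fun x => ?_
    rw [ENNReal.ofReal_mul (NNReal.coe_nonneg _), ENNReal.ofReal_coe_nnreal]
  rw [e1]
  calc ENNReal.ofReal (T hL.toLp) ≤ ‖T hL.toLp‖ₑ := by
        rw [← ofReal_norm]
        exact ENNReal.ofReal_le_ofReal (Real.le_norm_self _)
    _ ≤ ‖T‖ₑ * ‖hL.toLp‖ₑ := T.le_opENorm _
    _ ≤ _ := by
        gcongr
        rw [Lp.enorm_toLp, eLpNorm_eq_lintegral_rpow_enorm_toReal (by positivity) hs]
        gcongr with x
        rw [enorm_smul]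
        calc _ ≤ (ψ x : ℝ≥0∞) * 1 := by
              gcongr
              · simp
              · rw [← ofReal_norm, ← ENNReal.ofReal_one]
                exact ENNReal.ofReal_le_ofReal (hb1 x)
          _ = _ := mul_one _

end Majorant

/-! ### The dual of `L^s(μ; E)` -/

/-- By the Lindelöf property every open set is a countable union of balls. -/
theorem measurable_of_forall_measurableSet_dist_lt {Ω Y : Type*} [MeasurableSpace Ω]
    [PseudoMetricSpace Y] [SecondCountableTopology Y] [MeasurableSpace Y] [BorelSpace Y]
    {f : Ω → Y} (h : ∀ (y : Y) (c : ℝ), MeasurableSet {x | dist (f x) y < c}) :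
    Measurable f := by
  refine measurable_of_isOpen fun U hU => ?_
  have hr : ∀ y : U, ∃ r > 0, Metric.ball (y : Y) r ⊆ U := fun y => Metric.isOpen_iff.1 hU y y.2
  choose r hr0 hr using hr
  obtain ⟨S, hS, hSU⟩ := TopologicalSpace.isOpen_iUnion_countable
    (fun y : U => Metric.ball (y : Y) (r y)) fun _ => Metric.isOpen_ball
  have hU' : U = ⋃ y ∈ S, Metric.ball (y : Y) (r y) := by
    rw [hSU]
    exact Set.Subset.antisymm
      (fun y hy => Set.mem_iUnion.2 ⟨⟨y, hy⟩, Metric.mem_ball_self (hr0 _)⟩)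
      (Set.iUnion_subset hr)
  rw [hU', Set.preimage_iUnion₂]
  exact MeasurableSet.biUnion hS fun y _ => h y (r y)

/-! ### Strong measurability and weak-* limits in the dual -/

section Norming

variable {E : Type*} [NormedAddCommGroup E] [NormedSpace ℝ E]

/-- Pettis' argument: `‖f x - y‖ ≤ c` amounts to countably many inequalities between measurable
functions, and balls determine measurability in the separable space `Y`. -/
theorem stronglyMeasurable_of_norming {Ω : Type*} [MeasurableSpace Ω]
    {Y : Submodule ℝ (StrongDual ℝ E)} (hY : TopologicalSpace.IsSeparable (Y : Set (StrongDual ℝ E)))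
    {e : ℕ → E} (he : ∀ y ∈ Y, ∀ c : ℝ, (∀ i, y (e i) ≤ c) → ‖y‖ ≤ c) (he1 : ∀ i, ‖e i‖ ≤ 1)
    {f : Ω → StrongDual ℝ E} (hf : ∀ x, f x ∈ Y) (hfe : ∀ i, Measurable fun x => f x (e i)) :
    StronglyMeasurable f := by
  have : TopologicalSpace.SeparableSpace Y := hY.separableSpace
  have : SecondCountableTopology Y := UniformSpace.secondCountable_of_separable Y
  borelize ↥Y
  have hm : Measurable fun x => (⟨f x, hf x⟩ : Y) := by
    refine measurable_of_forall_measurableSet_dist_lt fun y c => ?_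
    refine measurableSet_lt (measurable_of_Iic fun c => ?_) measurable_const
    have : (fun x => dist (⟨f x, hf x⟩ : Y) y) ⁻¹' Set.Iic c =
        ⋂ i, {x | f x (e i) - (y : StrongDual ℝ E) (e i) ≤ c} := by
      ext x
      have hd : dist (⟨f x, hf x⟩ : Y) y = ‖f x - y‖ := by
        rw [Subtype.dist_eq, dist_eq_norm]
      simp only [Set.mem_preimage, Set.mem_Iic, Set.mem_iInter, Set.mem_ofPred_eq, hd]
      constructor
      · intro h i
        rw [← sub_apply]
        exact (Real.le_norm_self _).trans
          (((f x - y).le_opNorm_of_le (he1 i)).trans ((mul_one _).trans_le h))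
      · exact fun h => he _ (Y.sub_mem (hf x) y.2) c h
    rw [this]
    exact MeasurableSet.iInter fun i =>
      measurableSet_le ((hfe i).sub measurable_const) measurable_const
  exact (continuous_subtype_val.comp_stronglyMeasurable hm.stronglyMeasurable)

/-- The values of a bounded operator from a separable space into `E*` lie in a separable weak-*
closed subspace, if `E` is reflexive or `E*` is separable. -/
theorem exists_separable_submodule {G : Type*} [NormedAddCommGroup G] [NormedSpace ℝ G]
    [TopologicalSpace.SeparableSpace G]
    (hE : IsReflexiveSpace E ∨ TopologicalSpace.SeparableSpace (StrongDual ℝ E))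
    (S : G →L[ℝ] StrongDual ℝ E) :
    ∃ Y : Submodule ℝ (StrongDual ℝ E),
      TopologicalSpace.IsSeparable (Y : Set (StrongDual ℝ E)) ∧ (∀ g, S g ∈ Y) ∧
      ∀ y : StrongDual ℝ E, (∀ e : E, (∀ z ∈ Y, z e = 0) → y e = 0) → y ∈ Y := by
  rcases hE with hE | hE
  · refine ⟨S.range.topologicalClosure, ?_,
      fun g => Submodule.le_topologicalClosure _ ⟨g, rfl⟩,
      fun y hy => mem_of_forall_eval_eq_zero hE
        (Submodule.isClosed_topologicalClosure _) hy⟩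
    rw [Submodule.topologicalClosure_coe]
    exact (TopologicalSpace.isSeparable_range S.continuous).closure
  · exact ⟨⊤, TopologicalSpace.IsSeparable.of_separableSpace _, by simp, by simp⟩

/-- Bounded nets in the dual have weak-* limits along ultrafilters. -/
theorem exists_ultrafilter_limit {ι : Type*} (U : Ultrafilter ι) {B : ι → StrongDual ℝ E} {c : ℝ}
    (hB : ∀ᶠ a in U, ‖B a‖ ≤ c) :
    ∃ y : StrongDual ℝ E, ∀ e, Tendsto (fun a => B a e) U (𝓝 (y e)) := by
  obtain ⟨y, -, hy⟩ := (WeakDual.isCompact_closedBall (𝕜 := ℝ) (E := E) 0 c).ultrafilter_le_nhds'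
    (U.map fun a => StrongDual.toWeakDual (B a)) (by
      rw [Ultrafilter.mem_map]
      filter_upwards [hB] with a ha
      simpa using ha)
  refine ⟨WeakDual.toStrongDual y, fun e => ?_⟩
  have h1 : Tendsto (fun a => StrongDual.toWeakDual (B a)) U (𝓝 y) := hy
  exact ((WeakDual.eval_continuous e).tendsto y).comp h1

end Norming

/-! ### Differentiation of the vector measure and representation of functionals -/

section Dual

variable {V E : Type*} [MetricSpace V] [SecondCountableTopology V] [MeasurableSpace V]
  [BorelSpace V] [HasBesicovitchCovering V] {μ : Measure V} [IsFiniteMeasure μ]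
  [NormedAddCommGroup E] [NormedSpace ℝ E] {p s : ℝ≥0∞} [Fact (1 ≤ p)] [Fact (1 ≤ s)]

/-- Averages of an operator into the dual that is dominated by an integrable function have pointwise
weak-* limits. -/
theorem exists_pointwise_limit {N : Set V → StrongDual ℝ E} {h : E → V → ℝ} {W : V → ℝ}
    (hW : Integrable W μ) (hint : ∀ e, Integrable (h e) μ)
    (hN : ∀ A, MeasurableSet A → ∀ e, N A e = ∫ x in A, h e x ∂μ)
    (hNW : ∀ A, MeasurableSet A → ‖N A‖ ≤ ∫ x in A, W x ∂μ)
    {Y : Submodule ℝ (StrongDual ℝ E)} (hYN : ∀ A, MeasurableSet A → N A ∈ Y)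
    (hY : ∀ y : StrongDual ℝ E, (∀ e : E, (∀ z ∈ Y, z e = 0) → y e = 0) → y ∈ Y) :
    ∃ f : V → StrongDual ℝ E, (∀ x, f x ∈ Y) ∧ (∀ᵐ x ∂μ, ‖f x‖ ≤ W x) ∧
      ∀ e, ∀ᵐ x ∂μ, f x e = h e x := by
  classical
  let v := Besicovitch.vitaliFamily μ
  -- An ultrafilter finer than the Vitali filter at `x` makes the averages converge by weak-*
  -- compactness, and keeps every limit already known along the Vitali filter.
  let U : V → Ultrafilter (Set V) := fun x => Ultrafilter.of (v.filterAt x)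
  have hU : ∀ x, (U x : Filter (Set V)) ≤ v.filterAt x := fun x => Ultrafilter.of_le _
  let B : Set V → StrongDual ℝ E := fun A => (μ.real A)⁻¹ • N A
  have hlim : ∀ᵐ x ∂μ, ∃ y : StrongDual ℝ E, y ∈ Y ∧ ‖y‖ ≤ W x ∧
      ∀ e, Tendsto (fun a => B a e) (U x) (𝓝 (y e)) := by
    filter_upwards [v.ae_tendsto_average hW.locallyIntegrable] with x hx
    have hx' := hx.mono_left (hU x)
    have hmeas : ∀ᶠ a in (U x : Filter (Set V)), MeasurableSet a := hU x (v.eventually_filterAt_measurableSet x)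
    have hBle : ∀ᶠ a in (U x : Filter (Set V)), ‖B a‖ ≤ ⨍ y in a, W y ∂μ := by
      filter_upwards [hmeas] with a ha
      rw [setAverage_eq, norm_smul, smul_eq_mul, Real.norm_of_nonneg (by positivity)]
      exact mul_le_mul_of_nonneg_left (hNW a ha) (by positivity)
    -- The bound `W x + 1` serves only for compactness; the sharp bound `W x` is recovered in the
    -- limit.
    obtain ⟨y, hy⟩ := exists_ultrafilter_limit (U x) (B := B) (c := W x + 1) (by
      filter_upwards [hBle, hx'.eventually_lt_const (lt_add_one (W x))] with a h1 h2
      exact h1.trans h2.le)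
    refine ⟨y, hY y fun e he => ?_, ?_, hy⟩
    -- A vector annihilating `Y` annihilates all averages, hence their limit; so the limit lies in
    -- the weak-* closed `Y`.
    · refine tendsto_nhds_unique (hy e) (tendsto_const_nhds.congr' ?_)
      filter_upwards [hmeas] with a ha
      exact (he _ (Y.smul_mem _ (hYN a ha))).symm
    · have hW0 : 0 ≤ W x := by
        refine ge_of_tendsto hx' ?_
        filter_upwards [hBle] with a ha
        exact (norm_nonneg _).trans ha
      refine y.opNorm_le_bound hW0 fun e => ?_
      refine le_of_tendsto_of_tendsto (hy e).norm (hx'.mul_const ‖e‖) ?_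
      filter_upwards [hBle] with a ha
      exact (B a).le_of_opNorm_le ha e
  refine ⟨fun x => if hx : ∃ y : StrongDual ℝ E, y ∈ Y ∧ ‖y‖ ≤ W x ∧
      ∀ e, Tendsto (fun a => B a e) (U x) (𝓝 (y e)) then hx.choose else 0, fun x => ?_, ?_,
      fun e => ?_⟩
  · by_cases hx : ∃ y : StrongDual ℝ E, y ∈ Y ∧ ‖y‖ ≤ W x ∧
      ∀ e, Tendsto (fun a => B a e) (U x) (𝓝 (y e))
    · simp only [dif_pos hx]
      exact hx.choose_spec.1
    · simp only [dif_neg hx]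
      exact Y.zero_mem
  · filter_upwards [hlim] with x hx
    rw [dif_pos hx]
    exact hx.choose_spec.2.1
  · filter_upwards [hlim, v.ae_tendsto_average (hint e).locallyIntegrable] with x hx hxe
    rw [dif_pos hx]
    refine tendsto_nhds_unique (hx.choose_spec.2.2 e) ((hxe.mono_left (hU x)).congr' ?_)
    filter_upwards [hU x (v.eventually_filterAt_measurableSet x)] with a ha
    rw [setAverage_eq, ← hN a ha]
    rfl

/-- A functional on `L^s(μ; E)` is represented by a function in `L^p(μ; E*)`, when `E` is reflexive
or `E*` is separable. -/
theorem exists_representing_function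
    (hE : IsReflexiveSpace E ∨ TopologicalSpace.SeparableSpace (StrongDual ℝ E))
    [p.HolderConjugate s] (hp' : p ≠ ∞) (hs : s ≠ ∞)
    (T : StrongDual ℝ (Lp E s μ)) :
    ∃ f : V → StrongDual ℝ E, MemLp f p μ ∧ eLpNorm f p μ ≤ ‖T‖ₑ ∧
      ∀ g : Lp E s μ, T g = ∫ x, f x (g x) ∂μ := by
  classical
  have : Fact (s ≠ ∞) := ⟨hs⟩
  have hp1 : (1 : ℝ≥0∞) ≤ p := Fact.out
  obtain ⟨Y, hYsep, hYS, hY⟩ := exists_separable_submodule hE (toDualOperator T)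
  obtain ⟨e, he1, henorm⟩ := exists_norming_seq hYsep
  choose H Hm Hint HT using exists_scalar_density hs T
  -- The density at the vector `0` vanishes only almost everywhere; it is made zero everywhere, as
  -- the selection of maxima requires.
  let h : E → V → ℝ := fun z => if z = 0 then 0 else H z
  have h0 : h 0 = 0 := if_pos rfl
  have hm : ∀ z, Measurable (h z) := fun z => by
    by_cases hz : z = 0
    · simp [h, hz, measurable_zero]
    · simp [h, hz, Hm z]
  have hint : ∀ z, Integrable (h z) μ := fun z => by
    by_cases hz : z = 0
    · simp only [h, hz, if_true]
      exact integrable_zero _ _ _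
    · simp [h, hz, Hint z]
  have hT : ∀ z (A : Set V) (hA : MeasurableSet A),
      T (indicatorConstLp s hA (measure_ne_top μ _) z) = ∫ x in A, h z x ∂μ := fun z A hA => by
    by_cases hz : z = 0
    · have hzero : indicatorConstLp s hA (measure_ne_top μ _) (0 : E) = 0 := by
        rw [← norm_eq_zero]
        exact le_antisymm (norm_indicatorConstLp_le.trans (by simp)) (norm_nonneg _)
      simp [h, hz, hzero]
    · simp [h, hz, HT z A hA]
  set w : V → ℝ≥0∞ := fun x => ⨆ i, ENNReal.ofReal (h (e i) x) with hw
  have hwm : Measurable w := .iSup fun i => (hm _).ennreal_ofReal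
  have hwT : eLpNorm w p μ ≤ ‖T‖ₑ := eLpNorm_iSup_density_le hp' hs h0 hm hint hT he1
  have hwfin : ∀ᵐ x ∂μ, w x < ∞ := by
    have h1 : eLpNorm w p μ < ∞ := hwT.trans_lt enorm_lt_top
    have h2 := lintegral_rpow_enorm_lt_top_of_eLpNorm_lt_top (by positivity) hp' h1
    filter_upwards [ae_lt_top (by fun_prop) h2.ne] with x hx
    rw [enorm_eq_self] at hx
    exact (ENNReal.rpow_lt_top_iff_of_pos (ENNReal.toReal_pos (by positivity) hp')).1 hx
  let W : V → ℝ := fun x => (w x).toReal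
  have hWT : eLpNorm W p μ ≤ ‖T‖ₑ := by
    refine (eLpNorm_mono_enorm fun x => ?_).trans hwT
    simp only [W, enorm_eq_self]
    rw [Real.enorm_eq_ofReal ENNReal.toReal_nonneg]
    exact ENNReal.ofReal_toReal_le
  have hWL : MemLp W p μ :=
    ⟨hwm.ennreal_toReal.aestronglyMeasurable, hWT.trans_lt enorm_lt_top⟩
  have hWint : Integrable W μ := hWL.integrable hp1
  have hhW : ∀ i, ∀ᵐ x ∂μ, h (e i) x ≤ W x := fun i => by
    filter_upwards [hwfin] with x hx
    refine (ENNReal.ofReal_le_iff_le_toReal hx.ne).1 ?_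
    exact le_iSup (fun i => ENNReal.ofReal (h (e i) x)) i
  let N : Set V → StrongDual ℝ E := fun A =>
    if hA : MeasurableSet A then
      toDualOperator T (indicatorConstLp s hA (measure_ne_top μ _) 1) else 0
  have hNA : ∀ A (hA : MeasurableSet A),
      N A = toDualOperator T (indicatorConstLp s hA (measure_ne_top μ _) 1) :=
    fun A hA => dif_pos hA
  have hN : ∀ A, MeasurableSet A → ∀ z, N A z = ∫ x in A, h z x ∂μ := fun A hA z => by
    rw [hNA A hA, toDualOperator_indicator, hT]
  have hNY : ∀ A, MeasurableSet A → N A ∈ Y := fun A hA => by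
    rw [hNA A hA]
    exact hYS _
  obtain ⟨f, hfY, hfW, hfh⟩ := exists_pointwise_limit hWint hint hN
    (fun A hA => henorm _ (hNY A hA) _ fun i => by
      rw [hN A hA]
      exact integral_mono_ae (hint _).restrict hWint.restrict (ae_restrict_of_ae (hhW i))) hNY hY
  have hfm : AEStronglyMeasurable f μ := by
    -- Outside one null set `f x (e i) = h (e i) x` for all `i` at once; replacing `f` by `0` there
    -- makes these evaluations measurable.
    obtain ⟨G, hGsub, hGm, hG⟩ := exists_measurable_superset_of_null
      (ae_iff.1 (ae_all_iff.2 fun i => hfh (e i)))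
    refine ⟨Gᶜ.indicator f, ?_, ?_⟩
    · refine stronglyMeasurable_of_norming hYsep henorm he1 (fun x => ?_) fun i => ?_
      · by_cases hx : x ∈ Gᶜ
        · rw [Set.indicator_of_mem hx]
          exact hfY x
        · rw [Set.indicator_of_notMem hx]
          exact Y.zero_mem
      · have : (fun x => Gᶜ.indicator f x (e i)) = Gᶜ.indicator (h (e i)) := by
          funext x
          by_cases hx : x ∈ Gᶜ
          · rw [Set.indicator_of_mem hx, Set.indicator_of_mem hx]
            by_contra hne
            exact hx (hGsub fun hall => hne (hall i))
          · rw [Set.indicator_of_notMem hx, Set.indicator_of_notMem hx]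
            rfl
        rw [this]
        exact (hm _).indicator hGm.compl
    · filter_upwards [compl_mem_ae_iff.2 hG] with x hx
      rw [Set.indicator_of_mem hx]
  have hfT : eLpNorm f p μ ≤ ‖T‖ₑ := by
    refine (eLpNorm_mono_ae ?_).trans hWT
    filter_upwards [hfW] with x hx
    exact hx.trans (Real.le_norm_self _)
  have hfL : MemLp f p μ := ⟨hfm, hfT.trans_lt enorm_lt_top⟩
  refine ⟨f, hfL, hfT, fun g => ?_⟩
  let P : StrongDual ℝ (Lp E s μ) :=
    (ContinuousLinearMap.id ℝ (StrongDual ℝ E)).lpPairing μ p s hfL.toLp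
  have hP : ∀ g : Lp E s μ, P g = ∫ x, f x (g x) ∂μ := fun g => by
    refine (ContinuousLinearMap.lpPairing_eq_integral _ _ _).trans (integral_congr_ae ?_)
    filter_upwards [hfL.coeFn_toLp] with x hx
    rw [hx]
    rfl
  -- Both sides are now continuous in `g`, so the identity need only be checked on indicators.
  rw [← hP]
  induction g using Lp.induction hs with
  | indicatorConst c hA hμA =>
    rename_i A
    rw [Lp.simpleFunc.coe_indicatorConst, hT c A hA, hP]
    have : ∫ x in A, h c x ∂μ = ∫ x, A.indicator (fun x => f x c) x ∂μ := by
      rw [integral_indicator hA]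
      exact integral_congr_ae (ae_restrict_of_ae ((hfh c).mono fun x hx => hx.symm))
    rw [this]
    refine integral_congr_ae ?_
    filter_upwards [indicatorConstLp_coeFn (p := s) (hs := hA) (hμs := measure_ne_top μ A)
      (c := c)] with x hx
    rw [hx]
    by_cases hxA : x ∈ A <;> simp [hxA]
  | add hf hg hd h1 h2 => rw [map_add, map_add, h1, h2]
  | isClosed => exact isClosed_eq T.continuous P.continuous

end Dual

/-! ### Dyadic cubes -/

section Cubes

variable {n : ℕ}

theorem dyadicCube_eq_preimage (q : DyadicIndex n) :
    dyadicCube q = WithLp.ofLp ⁻¹' (Set.univ.pi fun i => Set.Ico ((2 : ℝ) ^ (-q.1) * (q.2 i : ℝ))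
      ((2 : ℝ) ^ (-q.1) * ((q.2 i : ℝ) + 1))) := by
  ext x
  simp [dyadicCube, Set.mem_pi]

theorem measurableSet_dyadicCube (q : DyadicIndex n) : MeasurableSet (dyadicCube q) := by
  rw [dyadicCube_eq_preimage]
  exact (PiLp.volume_preserving_ofLp (Fin n)).measurable
    (MeasurableSet.univ_pi fun i => measurableSet_Ico)

theorem volume_dyadicCube (q : DyadicIndex n) :
    volume (dyadicCube q) = ENNReal.ofReal ((2 : ℝ) ^ (-q.1)) ^ n := by
  rw [dyadicCube_eq_preimage, (PiLp.volume_preserving_ofLp (Fin n)).measure_preimage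
    (MeasurableSet.univ_pi fun i => measurableSet_Ico).nullMeasurableSet, Real.volume_pi_Ico]
  have : ∀ i, (2 : ℝ) ^ (-q.1) * ((q.2 i : ℝ) + 1) - (2 : ℝ) ^ (-q.1) * (q.2 i : ℝ) =
      (2 : ℝ) ^ (-q.1) := fun i => by ring
  simp only [this, Finset.prod_const, Finset.card_univ, Fintype.card_fin]

theorem volume_dyadicCube_ne_zero (q : DyadicIndex n) : volume (dyadicCube q) ≠ 0 := by
  rw [volume_dyadicCube]
  exact pow_ne_zero _ (by simpa using zpow_pos (by norm_num) _)

theorem volume_dyadicCube_ne_top (q : DyadicIndex n) : volume (dyadicCube q) ≠ ∞ := by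
  rw [volume_dyadicCube]
  exact ENNReal.pow_ne_top ENNReal.ofReal_ne_top

instance (q : DyadicIndex n) : IsFiniteMeasure (volume.restrict (dyadicCube q)) :=
  ⟨by rw [Measure.restrict_apply_univ]; exact (volume_dyadicCube_ne_top q).lt_top⟩

/-- The index of the unit dyadic cube containing `x`. -/
noncomputable def unitIndex (x : EuclideanSpace ℝ (Fin n)) : DyadicIndex n := (0, fun i => ⌊x i⌋)

theorem mem_dyadicCube_zero {x : EuclideanSpace ℝ (Fin n)} {m : Fin n → ℤ} :
    x ∈ dyadicCube (0, m) ↔ unitIndex x = (0, m) := by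
  simp [dyadicCube, unitIndex, funext_iff, Int.floor_eq_iff]

/-- The power `|Q|^{1/s - 1/u}` of the volume of a dyadic cube. -/
noncomputable def cubeWeight (s u : ℝ≥0∞) (q : DyadicIndex n) : ℝ≥0∞ :=
  volume (dyadicCube q) ^ ((s⁻¹).toReal - (u⁻¹).toReal)

theorem cubeWeight_ne_zero (s u : ℝ≥0∞) (q : DyadicIndex n) : cubeWeight s u q ≠ 0 := by
  simp [cubeWeight, ENNReal.rpow_eq_zero_iff, volume_dyadicCube_ne_zero, volume_dyadicCube_ne_top]

theorem cubeWeight_ne_top (s u : ℝ≥0∞) (q : DyadicIndex n) : cubeWeight s u q ≠ ∞ := by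
  simp [cubeWeight, ENNReal.rpow_eq_top_iff, volume_dyadicCube_ne_zero, volume_dyadicCube_ne_top]

/-- The Morrey weight equals the block normalization: this is `1/p + 1/s = 1 = 1/t + 1/u`. -/
theorem cubeWeight_conj {p s t u : ℝ≥0∞} [p.HolderConjugate s] [t.HolderConjugate u]
    (q : DyadicIndex n) : cubeWeight t p q = cubeWeight s u q := by
  have h1 : ∀ a b : ℝ≥0∞, a.HolderConjugate b → (a⁻¹).toReal + (b⁻¹).toReal = 1 :=
    fun a b hab => by
      have h2 : a⁻¹ + b⁻¹ = 1 := ENNReal.HolderConjugate.inv_add_inv_eq_one a b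
      have ha : a⁻¹ ≠ ∞ := fun h => by simp [h] at h2
      have hb : b⁻¹ ≠ ∞ := fun h => by simp [h] at h2
      rw [← ENNReal.toReal_add ha hb, h2, ENNReal.toReal_one]
  unfold cubeWeight
  congr 1
  linarith [h1 p s inferInstance, h1 t u inferInstance]

end Cubes

/-! ### Embedding of `L^s(Q; E)` into the block space -/

section Block

variable {n : ℕ} {E : Type*} [NormedAddCommGroup E]

theorem ellNorm_lt_top_of_finset {w : ℝ≥0∞} (F : Finset (DyadicIndex n)) (c : DyadicIndex n → ℝ) :
    ellNorm (fun q => if q ∈ F then c q else 0) w < ∞ := by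
  have h : (fun q => if q ∈ F then c q else 0) =
      fun q => ∑ a ∈ F, (Set.indicator {a} (fun _ => c a)) q := by
    funext q
    simp [Set.indicator_apply, Finset.sum_ite_eq]
  rw [h]
  exact (memLp_finsetSum (μ := Measure.count) (p := w) F fun a _ =>
    memLp_indicator_const w (measurableSet_singleton a) (c a) (Or.inr (by simp))).2

theorem hasSum_ite_mem {ι : Type*} [DecidableEq ι] (F : Finset ι) (a : ι → E) :
    HasSum (fun q => if q ∈ F then a q else 0) (∑ q ∈ F, a q) := by
  have h := hasSum_sum_of_ne_finset_zero (L := SummationFilter.unconditional ι)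
    (f := fun q => if q ∈ F then a q else 0) (s := F)
    (fun q hq => if_neg hq)
  rwa [Finset.sum_congr rfl fun q hq => if_pos hq] at h

variable [NormedSpace ℝ E]

theorem isAdmissible_of_eLpNorm_le {s u w : ℝ≥0∞} {g : EuclideanSpace ℝ (Fin n) → E}
    {G : DyadicIndex n → EuclideanSpace ℝ (Fin n) → E} {lam : DyadicIndex n → ℝ} (hs : s ≠ 0)
    (h0 : ∀ q, 0 ≤ lam q) (hlam : ellNorm lam w < ∞)
    (hGm : ∀ q, AEStronglyMeasurable (G q) volume)
    (hGs : ∀ q, ∀ᵐ x ∂volume, x ∉ dyadicCube q → G q x = 0)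
    (hG : ∀ q, eLpNorm (G q) s volume ≤ ENNReal.ofReal (lam q) * cubeWeight s u q)
    (hsum : ∀ᵐ x ∂volume, HasSum (fun q => G q x) (g x)) : IsAdmissible s u w g lam := by
  refine ⟨hlam, fun q => (lam q)⁻¹ • G q, fun q => ⟨(hGm q).const_smul _, ?_, ?_⟩, ?_⟩
  · filter_upwards [hGs q] with x hx hxq
    simp [hx hxq]
  · rw [eLpNorm_const_smul]
    rcases (h0 q).eq_or_lt with h | h
    · simp [← h]
    · calc ‖(lam q)⁻¹‖ₑ * eLpNorm (G q) s volume
          ≤ ‖(lam q)⁻¹‖ₑ * (ENNReal.ofReal (lam q) * cubeWeight s u q) := by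
            gcongr
            exact hG q
        _ = cubeWeight s u q := by
            rw [Real.enorm_eq_ofReal (inv_nonneg.2 h.le), ← mul_assoc,
              ← ENNReal.ofReal_mul (inv_nonneg.2 h.le), inv_mul_cancel₀ h.ne', ENNReal.ofReal_one,
              one_mul]
  -- Where `lam q = 0` the block is zero by `0⁻¹ = 0`, so nothing is lost only because the norm
  -- bound forces `G q = 0` almost everywhere.
  · have hzero : ∀ q, ∀ᵐ x ∂volume, lam q = 0 → G q x = 0 := fun q => by
      by_cases h : lam q = 0
      · have h1 := hG q
        rw [h, ENNReal.ofReal_zero, zero_mul, nonpos_iff_eq_zero,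
          eLpNorm_eq_zero_iff (hGm q) hs] at h1
        filter_upwards [h1] with x hx _
        exact hx
      · exact Eventually.of_forall fun x hx => absurd hx h
    filter_upwards [hsum, ae_all_iff.2 hzero] with x hx hx0
    convert hx using 2 with q
    by_cases h : lam q = 0
    · simp [h, hx0 q h]
    · simp [smul_smul, h]

/-- Extension by zero of functions on a dyadic cube. -/
noncomputable def extendZero (s : ℝ≥0∞) (q : DyadicIndex n) :
    Lp E s (volume.restrict (dyadicCube q)) →ₗ[ℝ] (EuclideanSpace ℝ (Fin n) →ₘ[volume] E) where
  toFun g := AEEqFun.mk ((dyadicCube q).indicator g)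
    ((aestronglyMeasurable_indicator_iff (measurableSet_dyadicCube q)).2 (Lp.aestronglyMeasurable g))
  map_add' f g := by
    apply AEEqFun.ext
    refine (AEEqFun.coeFn_mk _ _).trans (EventuallyEq.trans ?_ (AEEqFun.coeFn_add _ _).symm)
    filter_upwards [AEEqFun.coeFn_mk _ ((aestronglyMeasurable_indicator_iff
      (measurableSet_dyadicCube q)).2 (Lp.aestronglyMeasurable f)),
      AEEqFun.coeFn_mk _ ((aestronglyMeasurable_indicator_iff
      (measurableSet_dyadicCube q)).2 (Lp.aestronglyMeasurable g)),
      (ae_restrict_iff' (measurableSet_dyadicCube q)).1 (Lp.coeFn_add f g)] with x h1 h2 h3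
    rw [Pi.add_apply, h1, h2]
    by_cases hx : x ∈ dyadicCube q
    · simp only [Set.indicator_of_mem hx]
      exact h3 hx
    · simp [hx]
  map_smul' c g := by
    apply AEEqFun.ext
    refine (AEEqFun.coeFn_mk _ _).trans (EventuallyEq.trans ?_ (AEEqFun.coeFn_smul _ _).symm)
    filter_upwards [AEEqFun.coeFn_mk _ ((aestronglyMeasurable_indicator_iff
      (measurableSet_dyadicCube q)).2 (Lp.aestronglyMeasurable g)),
      (ae_restrict_iff' (measurableSet_dyadicCube q)).1 (Lp.coeFn_smul c g)] with x h1 h3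
    rw [Pi.smul_apply, RingHom.id_apply, h1]
    by_cases hx : x ∈ dyadicCube q
    · simp [hx, h3 hx]
    · simp [hx]

theorem coeFn_extendZero {s : ℝ≥0∞} (q : DyadicIndex n)
    (g : Lp E s (volume.restrict (dyadicCube q))) :
    extendZero s q g =ᵐ[volume] (dyadicCube q).indicator g :=
  AEEqFun.coeFn_mk _ _

theorem coeFn_sum_extendZero {s : ℝ≥0∞} (F : Finset (DyadicIndex n))
    (g : ∀ q, Lp E s (volume.restrict (dyadicCube q))) :
    ⇑(∑ q ∈ F, extendZero s q (g q)) =ᵐ[volume]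
      fun x => ∑ q ∈ F, (dyadicCube q).indicator (g q) x := by
  induction F using Finset.induction_on with
  | empty => simpa using! AEEqFun.coeFn_zero
  | insert a F ha ih =>
    rw [Finset.sum_insert ha]
    refine (AEEqFun.coeFn_add _ _).trans ?_
    filter_upwards [ih, coeFn_extendZero a (g a)] with x h1 h2
    rw [Pi.add_apply, h1, h2, Finset.sum_insert ha]

variable {s u w : ℝ≥0∞} [Fact (1 ≤ s)]

/-- The coefficient of a cube is the least one that turns its summand into a multiple of a block.
The case of a single cube bounds the embedding; the general case is needed for testing functionals.
-/
theorem isAdmissible_sum_extendZero (F : Finset (DyadicIndex n))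
    (g : ∀ q, Lp E s (volume.restrict (dyadicCube q))) :
    IsAdmissible s u w ⇑(∑ q ∈ F, extendZero s q (g q))
      (fun q => if q ∈ F then ((cubeWeight s u q)⁻¹).toReal * ‖g q‖ else 0) := by
  have hs1 : (1 : ℝ≥0∞) ≤ s := Fact.out
  refine IsAdmissible.congr (isAdmissible_of_eLpNorm_le (G := fun q =>
    if q ∈ F then (dyadicCube q).indicator (g q) else 0) (by positivity) (fun q => ?_)
    (ellNorm_lt_top_of_finset F _) (fun q => ?_) (fun q => ?_) (fun q => ?_)
    (Eventually.of_forall fun x => ?_)) (coeFn_sum_extendZero F g).symm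
  · split_ifs <;> positivity
  · split_ifs
    · exact (aestronglyMeasurable_indicator_iff (measurableSet_dyadicCube q)).2
        (Lp.aestronglyMeasurable _)
    · exact aestronglyMeasurable_zero
  · refine Eventually.of_forall fun x hx => ?_
    split_ifs <;> simp [hx]
  · split_ifs
    · rw [eLpNorm_indicator_eq_eLpNorm_restrict (measurableSet_dyadicCube q),
        ENNReal.ofReal_mul ENNReal.toReal_nonneg, ENNReal.ofReal_toReal
        (ENNReal.inv_ne_top.2 (cubeWeight_ne_zero _ _ _)), ofReal_norm, mul_right_comm,
        ENNReal.inv_mul_cancel (cubeWeight_ne_zero _ _ _) (cubeWeight_ne_top _ _ _), one_mul,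
        Lp.enorm_def]
    · simp
  · convert hasSum_ite_mem F fun q => (dyadicCube q).indicator (g q) x using 2 with q
    split_ifs <;> rfl

variable [Fact (1 ≤ w)]

theorem extendZero_mem (q : DyadicIndex n) (g : Lp E s (volume.restrict (dyadicCube q))) :
    extendZero s q g ∈ BlockSpace n E s u w := by
  classical
  have h := isAdmissible_sum_extendZero (u := u) (w := w) {q}
    (Function.update (0 : ∀ q, Lp E s (volume.restrict (dyadicCube q))) q g)
  rw [Finset.sum_singleton, Function.update_self] at h
  exact ⟨_, h⟩

/-- Extension by zero as a linear map into the block space. -/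
noncomputable def cubeEmbeddingₗ (s u w : ℝ≥0∞) [Fact (1 ≤ s)] [Fact (1 ≤ w)] (q : DyadicIndex n) :
    Lp E s (volume.restrict (dyadicCube q)) →ₗ[ℝ] BlockSpace n E s u w :=
  (extendZero s q).codRestrict (BlockSpace n E s u w) (extendZero_mem q)

theorem ofReal_norm_eq_blockENorm (g : BlockSpace n E s u w) :
    ENNReal.ofReal ‖g‖ = blockENorm s u w (g : EuclideanSpace ℝ (Fin n) → E) := by
  rw [BlockSpace.norm_def, ENNReal.ofReal_toReal (BlockSpace.blockENorm_ne_top g)]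

theorem ofReal_norm_sum_cubeEmbeddingₗ_le (F : Finset (DyadicIndex n))
    (g : ∀ q, Lp E s (volume.restrict (dyadicCube q))) :
    ENNReal.ofReal ‖∑ q ∈ F, cubeEmbeddingₗ s u w q (g q)‖ ≤
      ellNorm (fun q => if q ∈ F then ((cubeWeight s u q)⁻¹).toReal * ‖g q‖ else 0) w := by
  rw [ofReal_norm_eq_blockENorm]
  refine iInf₂_le _ ?_
  have h := isAdmissible_sum_extendZero (u := u) (w := w) F g
  rw [Submodule.coe_sum]
  exact h

/-- Extension by zero as a bounded operator into the block space. -/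
noncomputable def cubeEmbedding (s u w : ℝ≥0∞) [Fact (1 ≤ s)] [Fact (1 ≤ w)] (q : DyadicIndex n) :
    Lp E s (volume.restrict (dyadicCube q)) →L[ℝ] BlockSpace n E s u w :=
  (cubeEmbeddingₗ s u w q).mkContinuous ((cubeWeight s u q)⁻¹).toReal fun g => by
    classical
    have hw : w ≠ 0 := (zero_lt_one.trans_le (Fact.out : 1 ≤ w)).ne'
    have h := ofReal_norm_sum_cubeEmbeddingₗ_le (u := u) (w := w) {q}
      (Function.update (0 : ∀ q, Lp E s (volume.restrict (dyadicCube q))) q g)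
    have e : (fun q' => if q' ∈ ({q} : Finset (DyadicIndex n)) then
        ((cubeWeight s u q')⁻¹).toReal *
          ‖Function.update (0 : ∀ q, Lp E s (volume.restrict (dyadicCube q))) q g q'‖ else 0) =
        Set.indicator {q} fun _ => ((cubeWeight s u q)⁻¹).toReal * ‖g‖ := by
      funext q'
      by_cases hq : q' = q
      · subst hq
        simp
      · simp [hq]
    rw [Finset.sum_singleton, Function.update_self, e, ellNorm, eLpNorm_indicator_const'
      (measurableSet_singleton q) (by simp) hw, Measure.count_singleton, ENNReal.one_rpow, mul_one,
      Real.enorm_eq_ofReal (by positivity)] at h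
    exact (ENNReal.ofReal_le_ofReal_iff (by positivity)).1 h

theorem coe_cubeEmbedding (q : DyadicIndex n) (g : Lp E s (volume.restrict (dyadicCube q))) :
    (cubeEmbedding s u w q g : EuclideanSpace ℝ (Fin n) →ₘ[volume] E) = extendZero s q g := rfl

theorem ofReal_norm_sum_cubeEmbedding_le (F : Finset (DyadicIndex n))
    (g : ∀ q, Lp E s (volume.restrict (dyadicCube q))) :
    ENNReal.ofReal ‖∑ q ∈ F, cubeEmbedding s u w q (g q)‖ ≤
      ellNorm (fun q => if q ∈ F then ((cubeWeight s u q)⁻¹).toReal * ‖g q‖ else 0) w :=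
  ofReal_norm_sum_cubeEmbeddingₗ_le F g

theorem tendsto_ellNorm_compl (hw : w ≠ ∞) {lam : DyadicIndex n → ℝ} (hlam : ellNorm lam w < ∞) :
    Tendsto (fun F : Finset (DyadicIndex n) => ellNorm (fun q => if q ∈ F then 0 else lam q) w)
      atTop (𝓝 0) := by
  have hw0 : w ≠ 0 := (zero_lt_one.trans_le (Fact.out : 1 ≤ w)).ne'
  have hwr : 0 < w.toReal := ENNReal.toReal_pos hw0 hw
  have h1 := lintegral_rpow_enorm_lt_top_of_eLpNorm_lt_top hw0 hw hlam
  rw [lintegral_count] at h1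
  have h2 := (ENNReal.tendsto_tsum_compl_atTop_zero h1.ne).ennrpow_const (1 / w.toReal)
  rw [ENNReal.zero_rpow_of_pos (by positivity)] at h2
  convert h2 using 2 with F
  rw [ellNorm, eLpNorm_eq_lintegral_rpow_enorm_toReal hw0 hw, lintegral_count]
  congr 1
  refine Eq.trans ?_ (tsum_subtype (F : Set (DyadicIndex n))ᶜ fun q => ‖lam q‖ₑ ^ w.toReal).symm
  refine tsum_congr fun q => ?_
  by_cases hq : q ∈ F <;> simp [hq, hwr]

/-- A functional on the block space is determined by its values on the functions of the cubes. -/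
theorem dual_ext (hw : w ≠ ∞) {L L' : StrongDual ℝ (BlockSpace n E s u w)}
    (h : ∀ q (g : Lp E s (volume.restrict (dyadicCube q))),
      L (cubeEmbedding s u w q g) = L' (cubeEmbedding s u w q g)) : L = L' := by
  rw [← sub_eq_zero]
  set D := L - L' with hD
  have hD0 : ∀ q (g : Lp E s (volume.restrict (dyadicCube q))),
      D (cubeEmbedding s u w q g) = 0 := fun q g => by
    rw [hD, sub_apply, h, sub_self]
  ext G
  obtain ⟨lam, hlam, b, hb, hsum⟩ := G.2
  have hbm : ∀ q, MemLp (fun x => lam q • b q x) s (volume.restrict (dyadicCube q)) := fun q =>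
    (MemLp.const_smul ⟨(hb q).1, (hb q).3.trans_lt (cubeWeight_ne_top s u q).lt_top⟩
      (lam q)).restrict _
  let g : ∀ q, Lp E s (volume.restrict (dyadicCube q)) := fun q => (hbm q).toLp
  have hg : ∀ q, extendZero s q (g q) =ᵐ[volume] fun x => lam q • b q x := fun q => by
    filter_upwards [coeFn_extendZero q (g q), (ae_restrict_iff' (measurableSet_dyadicCube q)).1
      (hbm q).coeFn_toLp, (hb q).2] with x h1 h2 h3
    rw [h1]
    by_cases hx : x ∈ dyadicCube q
    · rw [Set.indicator_of_mem hx, h2 hx]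
    · rw [Set.indicator_of_notMem hx, h3 hx, smul_zero]
  -- The remainder is represented by the same blocks, with the coefficients on `F` deleted; hence it
  -- tends to zero with the `ℓ^w` tail.
  have htail : ∀ F : Finset (DyadicIndex n),
      ENNReal.ofReal ‖G - ∑ q ∈ F, cubeEmbedding s u w q (g q)‖ ≤
        ellNorm (fun q => if q ∈ F then 0 else lam q) w := fun F => by
    rw [ofReal_norm_eq_blockENorm]
    refine iInf₂_le _ ⟨?_, b, hb, ?_⟩
    · refine (eLpNorm_mono fun q => ?_).trans_lt hlam
      by_cases hq : q ∈ F <;> simp [hq]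
    · have hcoe : ((G - ∑ q ∈ F, cubeEmbedding s u w q (g q) : BlockSpace n E s u w) :
          EuclideanSpace ℝ (Fin n) →ₘ[volume] E) = G - ∑ q ∈ F, extendZero s q (g q) := by
        rw [Submodule.coe_sub, Submodule.coe_sum]
        rfl
      rw [hcoe]
      filter_upwards [AEEqFun.coeFn_sub (G : EuclideanSpace ℝ (Fin n) →ₘ[volume] E)
        (∑ q ∈ F, extendZero s q (g q)), coeFn_sum_extendZero F g, hsum,
        ae_all_iff.2 hg, ae_all_iff.2 fun q => coeFn_extendZero q (g q)] with x h1 h2 h3 h4 h5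
      rw [h1, Pi.sub_apply, h2]
      have h6 : ∑ q ∈ F, (dyadicCube q).indicator (g q) x = ∑ q ∈ F, lam q • b q x :=
        Finset.sum_congr rfl fun q _ => by rw [← h5 q, h4 q]
      rw [h6]
      have h7 : HasSum (fun q => if q ∈ F then lam q • b q x else 0) (∑ q ∈ F, lam q • b q x) :=
        hasSum_ite_mem F _
      convert h3.sub h7 using 2 with q
      by_cases hq : q ∈ F <;> simp [hq]
  have hlim : Tendsto (fun F : Finset (DyadicIndex n) =>
      ‖G - ∑ q ∈ F, cubeEmbedding s u w q (g q)‖) atTop (𝓝 0) := by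
    have h1 := tendsto_of_tendsto_of_tendsto_of_le_of_le tendsto_const_nhds
      (tendsto_ellNorm_compl hw hlam) (fun _ => zero_le) htail
    have h2 := (ENNReal.tendsto_toReal ENNReal.zero_ne_top).comp h1
    simpa [Function.comp_def] using h2
  have hle : ∀ F : Finset (DyadicIndex n),
      ‖D G‖ ≤ ‖D‖ * ‖G - ∑ q ∈ F, cubeEmbedding s u w q (g q)‖ := fun F => by
    have h1 : D G = D (G - ∑ q ∈ F, cubeEmbedding s u w q (g q)) := by
      rw [map_sub, map_sum, Finset.sum_eq_zero fun q _ => hD0 q _, sub_zero]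
    rw [h1]
    exact D.le_opNorm _
  have h3 := ge_of_tendsto (hlim.const_mul ‖D‖) (Eventually.of_forall hle)
  rw [mul_zero] at h3
  simpa using h3

end Block

/-! ### The pairing of Bourgain–Morrey spaces and block spaces -/

/-- The endpoint `p = ∞`, `s = 1` is included since it is applied to sequences with `r = ∞`. -/
theorem lintegral_mul_le_eLpNorm {Ω : Type*} [MeasurableSpace Ω] {μ : Measure Ω} {p s : ℝ≥0∞}
    [hps : p.HolderConjugate s] (hs : s ≠ ∞) {φ ψ : Ω → ℝ≥0∞} (hφ : AEMeasurable φ μ)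
    (hψ : AEMeasurable ψ μ) : ∫⁻ x, φ x * ψ x ∂μ ≤ eLpNorm φ p μ * eLpNorm ψ s μ := by
  by_cases hp : p = ∞
  · subst hp
    have hs1 : s = 1 := by
      have h := ENNReal.HolderConjugate.inv_add_inv_eq_one ∞ s
      simpa using h
    rw [hs1, eLpNorm_one_eq_lintegral_enorm, eLpNorm_exponent_top,
      ← lintegral_const_mul'' _ (by fun_prop)]
    refine lintegral_mono_ae ?_
    filter_upwards [enorm_ae_le_eLpNormEssSup φ μ] with x hx
    rw [enorm_eq_self] at hx
    rw [enorm_eq_self]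
    gcongr
  · have h := ENNReal.HolderConjugate.toReal_of_ne_top hp hs
    rw [eLpNorm_eq_lintegral_rpow_enorm_toReal (fun h0 => h.ne_zero (by simp [h0])) hp,
      eLpNorm_eq_lintegral_rpow_enorm_toReal (fun h0 => h.symm.ne_zero (by simp [h0])) hs]
    simpa using ENNReal.lintegral_mul_le_Lp_mul_Lq μ h hφ hψ

section Pairing

variable {n : ℕ} {E : Type*} [NormedAddCommGroup E] [NormedSpace ℝ E] {p s t u r w : ℝ≥0∞}
  [p.HolderConjugate s] [t.HolderConjugate u] [r.HolderConjugate w]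

theorem lintegral_enorm_mul_block_le (hs : s ≠ ∞) {f : EuclideanSpace ℝ (Fin n) → StrongDual ℝ E}
    (hf : AEStronglyMeasurable f volume) {q : DyadicIndex n}
    {b : EuclideanSpace ℝ (Fin n) → E} (hb : IsBlock s u (dyadicCube q) b) :
    ∫⁻ x, ‖f x‖ₑ * ‖b x‖ₑ ≤ morreyTerm p t f q := by
  have h1 : ∫⁻ x, ‖f x‖ₑ * ‖b x‖ₑ = ∫⁻ x in dyadicCube q, ‖f x‖ₑ * ‖b x‖ₑ := by
    rw [← lintegral_indicator (measurableSet_dyadicCube q)]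
    refine lintegral_congr_ae ?_
    filter_upwards [hb.2] with x hx
    by_cases hxq : x ∈ dyadicCube q <;> simp [hxq, hx]
  rw [h1]
  refine (lintegral_mul_le_eLpNorm (p := p) hs hf.restrict.enorm hb.1.restrict.enorm).trans ?_
  rw [eLpNorm_enorm, eLpNorm_enorm, mul_comm]
  refine mul_le_mul' ?_ le_rfl
  change _ ≤ cubeWeight t p q
  rw [cubeWeight_conj (s := s) (u := u)]
  exact (eLpNorm_mono_measure _ Measure.restrict_le_self).trans hb.3

/-- The functional `f x` passes through the pointwise block sum; Hölder on each cube and then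
between `ℓ^r` and `ℓ^w` gives the estimate. -/
theorem lintegral_enorm_pairing_le (hs : s ≠ ∞) (hw : w ≠ ∞)
    {f : EuclideanSpace ℝ (Fin n) → StrongDual ℝ E}
    (hf : AEStronglyMeasurable f volume) {g : EuclideanSpace ℝ (Fin n) → E}
    {lam : DyadicIndex n → ℝ} (hg : IsAdmissible s u w g lam) :
    ∫⁻ x, ‖f x (g x)‖ₑ ≤ morreyENorm p t r f * ellNorm lam w := by
  obtain ⟨-, b, hb, hsum⟩ := hg
  calc ∫⁻ x, ‖f x (g x)‖ₑ
      ≤ ∫⁻ x, ∑' q, ‖lam q‖ₑ * (‖f x‖ₑ * ‖b q x‖ₑ) := by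
        refine lintegral_mono_ae ?_
        filter_upwards [hsum] with x hx
        rw [← (hx.mapL (f x)).tsum_eq]
        refine enorm_tsum_le_tsum_enorm.trans (ENNReal.tsum_le_tsum fun q => ?_)
        rw [map_smul, enorm_smul]
        gcongr
        exact (f x).le_opENorm _
    _ = ∑' q, ∫⁻ x, ‖lam q‖ₑ * (‖f x‖ₑ * ‖b q x‖ₑ) :=
        lintegral_tsum fun q => ((hf.enorm.mul (hb q).1.enorm).const_mul _)
    _ ≤ ∑' q, morreyTerm p t f q * ‖lam q‖ₑ := by
        refine ENNReal.tsum_le_tsum fun q => ?_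
        rw [lintegral_const_mul' _ _ enorm_ne_top, mul_comm]
        gcongr
        exact lintegral_enorm_mul_block_le hs hf (hb q)
    _ = ∫⁻ q, morreyTerm p t f q * ‖lam q‖ₑ ∂Measure.count := (lintegral_count _).symm
    _ ≤ _ := by
        refine (lintegral_mul_le_eLpNorm (p := r) hw (by fun_prop) (by fun_prop)).trans_eq ?_
        rw [eLpNorm_enorm]
        rfl

variable [Fact (1 ≤ s)] [Fact (1 ≤ w)]

theorem lintegral_enorm_pairing_le_norm (hs : s ≠ ∞) (hw : w ≠ ∞)
    {f : EuclideanSpace ℝ (Fin n) → StrongDual ℝ E}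
    (hf : AEStronglyMeasurable f volume) (hfM : morreyENorm p t r f < ∞)
    (g : BlockSpace n E s u w) :
    ∫⁻ x, ‖f x ((g : EuclideanSpace ℝ (Fin n) →ₘ[volume] E) x)‖ₑ ≤
      morreyENorm p t r f * ENNReal.ofReal ‖g‖ := by
  rw [ofReal_norm_eq_blockENorm, blockENorm]
  -- Moving the constant inside the infimum requires it to be nonzero; if it is zero, a single
  -- admissible family suffices.
  by_cases h0 : morreyENorm p t r f = 0
  · obtain ⟨lam, hlam⟩ := g.2
    have h := lintegral_enorm_pairing_le (p := p) (t := t) (r := r) hs hw hf hlam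
    rw [h0, zero_mul] at h ⊢
    exact h
  · simp only [ENNReal.mul_iInf_of_ne h0 hfM.ne]
    exact le_iInf₂ fun lam hlam => lintegral_enorm_pairing_le hs hw hf hlam

theorem aestronglyMeasurable_pairing {f : EuclideanSpace ℝ (Fin n) → StrongDual ℝ E}
    {g : EuclideanSpace ℝ (Fin n) → E} {μ : Measure (EuclideanSpace ℝ (Fin n))}
    (hf : AEStronglyMeasurable f μ) (hg : AEStronglyMeasurable g μ) :
    AEStronglyMeasurable (fun x => f x (g x)) μ :=
  (ContinuousLinearMap.id ℝ (StrongDual ℝ E)).aestronglyMeasurable_comp₂ hf hg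

theorem integrable_pairing (hs : s ≠ ∞) (hw : w ≠ ∞)
    {f : EuclideanSpace ℝ (Fin n) → StrongDual ℝ E}
    (hf : AEStronglyMeasurable f volume) (hfM : morreyENorm p t r f < ∞)
    (g : BlockSpace n E s u w) :
    Integrable (fun x => f x ((g : EuclideanSpace ℝ (Fin n) →ₘ[volume] E) x)) volume :=
  ⟨aestronglyMeasurable_pairing hf (AEEqFun.aestronglyMeasurable _),
    (lintegral_enorm_pairing_le_norm hs hw hf hfM g).trans_lt
      (ENNReal.mul_lt_top hfM ENNReal.ofReal_lt_top)⟩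

/-- Functions with finite Bourgain–Morrey norm act on the block space. -/
theorem exists_pairing_functional (hs : s ≠ ∞) (hw : w ≠ ∞)
    {f : EuclideanSpace ℝ (Fin n) → StrongDual ℝ E}
    (hf : AEStronglyMeasurable f volume) (hfM : morreyENorm p t r f < ∞) :
    ∃ J : StrongDual ℝ (BlockSpace n E s u w), ‖J‖ ≤ (morreyENorm p t r f).toReal ∧
      ∀ g : BlockSpace n E s u w,
        J g = ∫ x, f x ((g : EuclideanSpace ℝ (Fin n) →ₘ[volume] E) x) := by
  let J : BlockSpace n E s u w →ₗ[ℝ] ℝ :=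
    { toFun := fun g => ∫ x, f x ((g : EuclideanSpace ℝ (Fin n) →ₘ[volume] E) x)
      map_add' := fun g g' => by
        rw [← integral_add (integrable_pairing hs hw hf hfM g)
          (integrable_pairing hs hw hf hfM g')]
        refine integral_congr_ae ?_
        filter_upwards [AEEqFun.coeFn_add (g : EuclideanSpace ℝ (Fin n) →ₘ[volume] E) g'] with x hx
        rw [Submodule.coe_add, hx, Pi.add_apply, map_add]
      map_smul' := fun c g => by
        rw [RingHom.id_apply, ← integral_smul]
        refine integral_congr_ae ?_
        filter_upwards [AEEqFun.coeFn_smul c (g : EuclideanSpace ℝ (Fin n) →ₘ[volume] E)] with x hx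
        rw [Submodule.coe_smul, hx, Pi.smul_apply, map_smul] }
  refine ⟨J.mkContinuous (morreyENorm p t r f).toReal fun g => ?_,
    J.mkContinuous_norm_le ENNReal.toReal_nonneg _, fun g => rfl⟩
  have h := lintegral_enorm_pairing_le_norm hs hw hf hfM g
  refine (norm_integral_le_lintegral_norm _).trans ?_
  rw [← ENNReal.toReal_ofReal (norm_nonneg g), ← ENNReal.toReal_mul]
  refine ENNReal.toReal_mono (ENNReal.mul_lt_top hfM ENNReal.ofReal_lt_top).ne ?_
  simpa only [ofReal_norm] using h

end Pairing

/-! ### Representation of functionals on the block space -/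

section EllNorm

variable {n : ℕ} {r w : ℝ≥0∞} [r.HolderConjugate w]

/-- An `ℓ^r` norm is controlled by testing against finite families. -/
theorem ellNorm_le_of_forall_finset (hw : w ≠ ∞) {a : DyadicIndex n → ℝ≥0∞} {K : ℝ≥0∞}
    (h : ∀ (F : Finset (DyadicIndex n)) (ψ : DyadicIndex n → ℝ≥0), ∑ q ∈ F, ψ q * a q ≤
      K * ellNorm (fun q => if q ∈ F then (ψ q : ℝ) else 0) w) : ellNorm a r ≤ K := by
  have hsum := ENNReal.HolderConjugate.inv_add_inv_eq_one r w
  have hw0 : w ≠ 0 := fun h0 => by simp [h0] at hsum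
  have hr0 : r ≠ 0 := fun h0 => by simp [h0] at hsum
  by_cases hr : r = ∞
  -- For `r = ∞` it is enough to test single cubes with coefficient `1`.
  · rw [ellNorm, hr, eLpNorm_exponent_top, eLpNormEssSup_count]
    refine iSup_le fun q => ?_
    have h1 := h {q} 1
    have e : (fun q' => if q' ∈ ({q} : Finset (DyadicIndex n)) then
        (((1 : DyadicIndex n → ℝ≥0) q' : ℝ≥0) : ℝ) else 0) = Set.indicator {q} fun _ => 1 := by
      funext q'
      simp [Set.indicator_apply]
    rw [e, ellNorm, eLpNorm_indicator_const' (measurableSet_singleton q) (by simp) hw0] at h1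
    simpa using h1
  have hrw := ENNReal.HolderConjugate.toReal_of_ne_top hr hw
  have key : ∀ F : Finset (DyadicIndex n), ∑ q ∈ F, a q ^ r.toReal ≤ K ^ r.toReal := fun F => by
    have : IsFiniteMeasure ((Measure.count : Measure (DyadicIndex n)).restrict F) :=
      ⟨by simp⟩
    -- Restricted to `F`, the counting measure is finite, so the duality for `L^p` norms applies.
    have h1 := lintegral_rpow_le_of_forall_simpleFunc (φ := a) (K := K) hrw
      (μ := (Measure.count : Measure (DyadicIndex n)).restrict F) fun ψ => by
        have h2 := h F ψ
        rw [lintegral_finset, lintegral_finset]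
        simp only [Measure.count_singleton, mul_one]
        refine h2.trans_eq ?_
        rw [ellNorm, eLpNorm_eq_lintegral_rpow_enorm_toReal hw0 hw, lintegral_count,
          tsum_eq_sum (s := F) fun q hq => by simp [hq, hrw.symm.pos]]
        congr 2
        exact Finset.sum_congr rfl fun q hq => by simp [hq]
    rw [lintegral_finset, one_div, ENNReal.rpow_inv_le_iff hrw.pos] at h1
    simpa using h1
  rw [ellNorm, eLpNorm_eq_lintegral_rpow_enorm_toReal hr0 hr, lintegral_count, one_div,
    ENNReal.rpow_inv_le_iff hrw.pos, ENNReal.tsum_eq_iSup_sum]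
  exact iSup_le key

end EllNorm

/-! ### Uniqueness and compatibility on overlapping cubes -/

section Uniqueness

variable {n : ℕ} {E : Type*} [NormedAddCommGroup E] [NormedSpace ℝ E]

/-- A function with values in the dual is determined by its integrals against constants. -/
theorem ae_eq_of_forall_setIntegral_apply_eq {Ω : Type*} [MeasurableSpace Ω] {μ : Measure Ω}
    {B : Set Ω} (hB : MeasurableSet B) {f g : Ω → StrongDual ℝ E} (hf : IntegrableOn f B μ)
    (hg : IntegrableOn g B μ)
    (h : ∀ A ⊆ B, MeasurableSet A → ∀ e : E, ∫ x in A, f x e ∂μ = ∫ x in A, g x e ∂μ) :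
    f =ᵐ[μ.restrict B] g := by
  refine Integrable.ae_eq_of_forall_setIntegral_eq f g hf hg fun A hA _ => ?_
  rw [Measure.restrict_restrict hA]
  have hsub : A ∩ B ⊆ B := Set.inter_subset_right
  ext e
  rw [ContinuousLinearMap.integral_apply (hf.mono_set hsub),
    ContinuousLinearMap.integral_apply (hg.mono_set hsub)]
  exact h _ hsub (hA.inter hB) e

variable {s u w : ℝ≥0∞}

theorem integral_indicatorConstLp_apply {q : DyadicIndex n}
    (f : EuclideanSpace ℝ (Fin n) → StrongDual ℝ E) {A : Set (EuclideanSpace ℝ (Fin n))}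
    (hA : MeasurableSet A) (hAq : A ⊆ dyadicCube q) (e : E) :
    ∫ x in dyadicCube q, f x (indicatorConstLp s hA
      (measure_ne_top (volume.restrict (dyadicCube q)) _) e x) = ∫ x in A, f x e := by
  have h : ∫ x in A, f x e = ∫ x in dyadicCube q, A.indicator (fun x => f x e) x := by
    rw [integral_indicator hA, Measure.restrict_restrict hA, Set.inter_eq_self_of_subset_left hAq]
  rw [h]
  refine integral_congr_ae ?_
  filter_upwards [indicatorConstLp_coeFn (p := s) (hs := hA)
    (hμs := measure_ne_top (volume.restrict (dyadicCube q)) _) (c := e)] with x hx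
  rw [hx]
  by_cases hxA : x ∈ A <;> simp [hxA]

variable [Fact (1 ≤ s)] [Fact (1 ≤ w)]

theorem cubeEmbedding_indicatorConstLp_eq {q q' : DyadicIndex n}
    {A : Set (EuclideanSpace ℝ (Fin n))} (hA : MeasurableSet A) (hAq : A ⊆ dyadicCube q)
    (hAq' : A ⊆ dyadicCube q') (e : E) :
    cubeEmbedding s u w q (indicatorConstLp s hA
        (measure_ne_top (volume.restrict (dyadicCube q)) _) e) =
      cubeEmbedding s u w q' (indicatorConstLp s hA
        (measure_ne_top (volume.restrict (dyadicCube q')) _) e) := by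
  have h : ∀ q : DyadicIndex n, A ⊆ dyadicCube q → extendZero s q (indicatorConstLp s hA
      (measure_ne_top (volume.restrict (dyadicCube q)) _) e) =ᵐ[volume]
        A.indicator fun _ => e := fun q hAq => by
    filter_upwards [coeFn_extendZero q (indicatorConstLp s hA
      (measure_ne_top (volume.restrict (dyadicCube q)) _) e),
      (ae_restrict_iff' (measurableSet_dyadicCube q)).1 (indicatorConstLp_coeFn (p := s)
        (hs := hA) (hμs := measure_ne_top (volume.restrict (dyadicCube q)) _) (c := e))]
      with x h1 h2
    rw [h1]
    by_cases hx : x ∈ dyadicCube q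
    · rw [Set.indicator_of_mem hx, h2 hx]
    · rw [Set.indicator_of_notMem hx, Set.indicator_of_notMem fun hxA => hx (hAq hxA)]
  apply Subtype.ext
  rw [coe_cubeEmbedding, coe_cubeEmbedding]
  exact AEEqFun.ext ((h q hAq).trans (h q' hAq').symm)

theorem integral_cubeEmbedding (f : EuclideanSpace ℝ (Fin n) → StrongDual ℝ E) (q : DyadicIndex n)
    (g : Lp E s (volume.restrict (dyadicCube q))) :
    ∫ x, f x ((cubeEmbedding s u w q g : EuclideanSpace ℝ (Fin n) →ₘ[volume] E) x) =
      ∫ x in dyadicCube q, f x (g x) := by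
  rw [← integral_indicator (measurableSet_dyadicCube q), coe_cubeEmbedding]
  refine integral_congr_ae ?_
  filter_upwards [coeFn_extendZero q g] with x hx
  rw [hx]
  by_cases hxq : x ∈ dyadicCube q <;> simp [hxq]

end Uniqueness

/-! ### From dyadic cubes to local integrability -/

section Local

variable {n : ℕ} {X : Type*} [NormedAddCommGroup X]

theorem finite_unitIndex_image {K : Set (EuclideanSpace ℝ (Fin n))} (hK : IsCompact K) :
    (unitIndex '' K).Finite := by
  obtain ⟨R, hR⟩ := hK.isBounded.exists_norm_le
  refine ((Set.finite_Icc (fun _ : Fin n => ⌊-R⌋) fun _ => ⌊R⌋).image (Prod.mk (0 : ℤ))).subset ?_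
  rintro _ ⟨x, hx, rfl⟩
  have h : ∀ i, |x i| ≤ R := fun i => (PiLp.norm_apply_le x i).trans (hR x hx)
  exact ⟨fun i => ⌊x i⌋, ⟨fun i => Int.floor_mono (abs_le.1 (h i)).1,
    fun i => Int.floor_mono (abs_le.1 (h i)).2⟩, rfl⟩

theorem mem_dyadicCube_unitIndex (x : EuclideanSpace ℝ (Fin n)) : x ∈ dyadicCube (unitIndex x) :=
  mem_dyadicCube_zero.2 rfl

theorem aestronglyMeasurable_of_dyadicCube {f : EuclideanSpace ℝ (Fin n) → X}
    (hf : ∀ q, AEStronglyMeasurable f (volume.restrict (dyadicCube q))) :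
    AEStronglyMeasurable f volume := by
  have h := (aestronglyMeasurable_iUnion_iff (s := fun q : DyadicIndex n => dyadicCube q)).2 hf
  rwa [Set.eq_univ_of_forall fun x => Set.mem_iUnion.2 ⟨_, mem_dyadicCube_unitIndex x⟩,
    Measure.restrict_univ] at h

/-- A compact set meets only finitely many unit cubes. -/
theorem memLpLoc_of_dyadicCube {p : ℝ≥0∞} (hp0 : p ≠ 0) (hp : p ≠ ∞)
    {f : EuclideanSpace ℝ (Fin n) → X}
    (hf : ∀ q, MemLp f p (volume.restrict (dyadicCube q))) : MemLpLoc p f := by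
  have hm := aestronglyMeasurable_of_dyadicCube fun q => (hf q).1
  refine ⟨hm, fun K hK => ⟨hm.restrict, ?_⟩⟩
  rw [eLpNorm_lt_top_iff_lintegral_rpow_enorm_lt_top hp0 hp]
  have := (finite_unitIndex_image hK).fintype
  have hsub : K ⊆ ⋃ q : unitIndex '' K, dyadicCube (q : DyadicIndex n) := fun x hx =>
    Set.mem_iUnion.2 ⟨⟨_, x, hx, rfl⟩, mem_dyadicCube_unitIndex x⟩
  refine ((lintegral_mono_set hsub).trans (lintegral_iUnion_le _ _)).trans_lt ?_
  rw [tsum_fintype]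
  exact ENNReal.sum_lt_top.2 fun q _ =>
    (eLpNorm_lt_top_iff_lintegral_rpow_enorm_lt_top hp0 hp).1 (hf q).2

end Local

/-! ### Gluing the local representations -/

section Representation

variable {n : ℕ} {E : Type*} [NormedAddCommGroup E] [NormedSpace ℝ E] {p s t u r w : ℝ≥0∞}
  [Fact (1 ≤ p)] [Fact (1 ≤ s)] [Fact (1 ≤ w)]
  [p.HolderConjugate s] [t.HolderConjugate u] [r.HolderConjugate w]

/-- The defect is multiplicative so that one `θ` factors out of a sum over cubes, vanishing
functionals included. -/
theorem exists_almost_norming {G : Type*} [NormedAddCommGroup G] [NormedSpace ℝ G]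
    (T : StrongDual ℝ G) {θ : ℝ} (hθ : θ < 1) : ∃ g : G, ‖g‖ ≤ 1 ∧ θ * ‖T‖ ≤ T g := by
  rcases (norm_nonneg T).eq_or_lt with h | h
  · exact ⟨0, by simp, by simp [← h]⟩
  · obtain ⟨x, hx, hTx⟩ := T.exists_lt_apply_of_lt_opNorm (mul_lt_of_lt_one_left h hθ)
    rcases le_total 0 (T x) with h0 | h0
    · exact ⟨x, hx.le, by rw [Real.norm_of_nonneg h0] at hTx; exact hTx.le⟩
    · exact ⟨-x, by rw [norm_neg]; exact hx.le, by
        rw [Real.norm_of_nonpos h0] at hTx; rw [map_neg]; exact hTx.le⟩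

/-- The norms of the restrictions of a functional to the cubes, tested against finite families. -/
theorem sum_mul_norm_comp_cubeEmbedding_le (L : StrongDual ℝ (BlockSpace n E s u w))
    (F : Finset (DyadicIndex n)) (ψ : DyadicIndex n → ℝ≥0) :
    ∑ q ∈ F, (ψ q : ℝ≥0∞) * (cubeWeight s u q * ‖L ∘L cubeEmbedding s u w q‖ₑ) ≤
      ‖L‖ₑ * ellNorm (fun q => if q ∈ F then (ψ q : ℝ) else 0) w := by
  set N := ellNorm (fun q => if q ∈ F then (ψ q : ℝ) else 0) w with hN
  have hNfin : N ≠ ∞ := (ellNorm_lt_top_of_finset F _).ne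
  set c : DyadicIndex n → ℝ := fun q => (cubeWeight s u q).toReal with hc
  have hc0 : ∀ q, 0 < c q := fun q =>
    ENNReal.toReal_pos (cubeWeight_ne_zero _ _ _) (cubeWeight_ne_top _ _ _)
  set S : ℝ := ∑ q ∈ F, (ψ q : ℝ) * (c q * ‖L ∘L cubeEmbedding s u w q‖) with hS
  have hθ : ∀ θ : ℝ, θ < 1 → θ * S ≤ ‖L‖ * N.toReal := fun θ hθ => by
    choose g hg1 hg using fun q => exists_almost_norming (L ∘L cubeEmbedding s u w q) hθ
    -- Scaled so that the coefficient of the cube `q` in the block representation is `ψ q * ‖g q‖ ≤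
    -- ψ q`.
    let G : ∀ q, Lp E s (volume.restrict (dyadicCube q)) := fun q => ((ψ q : ℝ) * c q) • g q
    have h1 : θ * S ≤ L (∑ q ∈ F, cubeEmbedding s u w q (G q)) := by
      rw [hS, Finset.mul_sum, map_sum]
      refine Finset.sum_le_sum fun q _ => ?_
      have h2 : L (cubeEmbedding s u w q (G q)) =
          ((ψ q : ℝ) * c q) * (L ∘L cubeEmbedding s u w q) (g q) := by
        rw [← smul_eq_mul, ← map_smul]
        rfl
      rw [h2]
      calc θ * ((ψ q : ℝ) * (c q * ‖L ∘L cubeEmbedding s u w q‖)) =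
          ((ψ q : ℝ) * c q) * (θ * ‖L ∘L cubeEmbedding s u w q‖) := by ring
        _ ≤ _ := mul_le_mul_of_nonneg_left (hg q) (mul_nonneg (NNReal.coe_nonneg (ψ q)) (hc0 q).le)
    have h3 : ‖∑ q ∈ F, cubeEmbedding s u w q (G q)‖ ≤ N.toReal := by
      rw [← ENNReal.ofReal_le_iff_le_toReal hNfin]
      refine (ofReal_norm_sum_cubeEmbedding_le F G).trans (eLpNorm_mono fun q => ?_)
      split_ifs
      · rw [Real.norm_of_nonneg (by positivity), Real.norm_of_nonneg (NNReal.coe_nonneg (ψ q)), norm_smul,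
          Real.norm_of_nonneg (mul_nonneg (NNReal.coe_nonneg (ψ q)) (hc0 q).le), ENNReal.toReal_inv]
        calc (c q)⁻¹ * ((ψ q : ℝ) * c q * ‖g q‖) = (ψ q : ℝ) * ‖g q‖ * ((c q)⁻¹ * c q) := by ring
          _ = (ψ q : ℝ) * ‖g q‖ := by rw [inv_mul_cancel₀ (hc0 q).ne', mul_one]
          _ ≤ (ψ q : ℝ) := mul_le_of_le_one_right (NNReal.coe_nonneg (ψ q)) (hg1 q)
      · exact le_rfl
    calc θ * S ≤ L (∑ q ∈ F, cubeEmbedding s u w q (G q)) := h1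
      _ ≤ ‖L‖ * ‖∑ q ∈ F, cubeEmbedding s u w q (G q)‖ :=
        (Real.le_norm_self _).trans (L.le_opNorm _)
      _ ≤ _ := by gcongr
  have hSle : S ≤ ‖L‖ * N.toReal := by
    -- This is the limit `θ → 1`.
    by_contra! h
    have hS0 : 0 < S := lt_of_le_of_lt (by positivity) h
    obtain ⟨θ, h1, h2⟩ := exists_between ((div_lt_one hS0).2 h)
    exact absurd (hθ θ h2) (not_le.2 ((div_lt_iff₀ hS0).1 h1))
  have e1 : ∑ q ∈ F, (ψ q : ℝ≥0∞) * (cubeWeight s u q * ‖L ∘L cubeEmbedding s u w q‖ₑ) =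
      ENNReal.ofReal S := by
    rw [hS, ENNReal.ofReal_sum_of_nonneg fun q _ =>
      mul_nonneg (NNReal.coe_nonneg (ψ q)) (mul_nonneg (hc0 q).le (norm_nonneg _))]
    refine Finset.sum_congr rfl fun q _ => ?_
    rw [ENNReal.ofReal_mul (NNReal.coe_nonneg _), ENNReal.ofReal_mul (hc0 q).le,
      ENNReal.ofReal_coe_nnreal, ofReal_norm, ENNReal.ofReal_toReal (cubeWeight_ne_top _ _ _)]
  rw [e1]
  refine (ENNReal.ofReal_le_ofReal hSle).trans_eq ?_
  rw [ENNReal.ofReal_mul (norm_nonneg _), ofReal_norm, ENNReal.ofReal_toReal hNfin]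

/-- Every functional on the block space is given by a function of the Bourgain–Morrey space. -/
theorem exists_morrey_representation
    (hE : IsReflexiveSpace E ∨ TopologicalSpace.SeparableSpace (StrongDual ℝ E))
    (hp : p ≠ ∞) (hs : s ≠ ∞) (hw : w ≠ ∞) (L : StrongDual ℝ (BlockSpace n E s u w)) :
    ∃ f : EuclideanSpace ℝ (Fin n) → StrongDual ℝ E, MemLpLoc p f ∧
      morreyENorm p t r f ≤ ‖L‖ₑ ∧ ∀ g : BlockSpace n E s u w,
        L g = ∫ x, f x ((g : EuclideanSpace ℝ (Fin n) →ₘ[volume] E) x) := by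
  have hp1 : (1 : ℝ≥0∞) ≤ p := Fact.out
  choose f hfL hfn hfT using fun q : DyadicIndex n =>
    exists_representing_function (μ := volume.restrict (dyadicCube q)) hE hp hs
      (L ∘L cubeEmbedding s u w q)
  have hval : ∀ (q : DyadicIndex n) (A : Set (EuclideanSpace ℝ (Fin n))) (hA : MeasurableSet A),
      A ⊆ dyadicCube q → ∀ e : E, L (cubeEmbedding s u w q (indicatorConstLp s hA
        (measure_ne_top (volume.restrict (dyadicCube q)) _) e)) = ∫ x in A, f q x e :=
    fun q A hA hAq e => by
      rw [← integral_indicatorConstLp_apply (s := s) (f q) hA hAq e, ← hfT]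
      rfl
  have hint : ∀ q, IntegrableOn (f q) (dyadicCube q) volume := fun q => (hfL q).integrable hp1
  -- Both densities represent `L` on `1_A e` for `A` inside the intersection, and the extension by
  -- zero of `1_A e` does not depend on the cube.
  have hcons : ∀ q q' : DyadicIndex n, ∀ᵐ x ∂volume,
      x ∈ dyadicCube q → x ∈ dyadicCube q' → f q x = f q' x := fun q q' => by
    have hB := (measurableSet_dyadicCube q).inter (measurableSet_dyadicCube q')
    have h := ae_eq_of_forall_setIntegral_apply_eq hB
      ((hint q).mono_set Set.inter_subset_left) ((hint q').mono_set Set.inter_subset_right)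
      fun A hA hAm e => by
        rw [← hval q A hAm (hA.trans Set.inter_subset_left),
          ← hval q' A hAm (hA.trans Set.inter_subset_right),
          cubeEmbedding_indicatorConstLp_eq hAm (hA.trans Set.inter_subset_left)
            (hA.trans Set.inter_subset_right)]
    filter_upwards [(ae_restrict_iff' hB).1 h] with x hx h1 h2
    exact hx ⟨h1, h2⟩
  -- The unit cubes partition the space, so they define `φ`; agreement on larger and smaller cubes
  -- follows from the countably many overlap relations.
  let φ : EuclideanSpace ℝ (Fin n) → StrongDual ℝ E := fun x => f (unitIndex x) x
  have hφ : ∀ q, φ =ᵐ[volume.restrict (dyadicCube q)] f q := fun q => by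
    rw [EventuallyEq, ae_restrict_iff' (measurableSet_dyadicCube q)]
    filter_upwards [ae_all_iff.2 fun q' => hcons q' q] with x hx hxq
    exact hx _ (mem_dyadicCube_unitIndex x) hxq
  have hφloc : MemLpLoc p φ := memLpLoc_of_dyadicCube (by positivity) hp fun q =>
    (hfL q).ae_eq (hφ q).symm
  have hφM : morreyENorm p t r φ ≤ ‖L‖ₑ := by
    refine ellNorm_le_of_forall_finset hw fun F ψ =>
      (Finset.sum_le_sum fun q _ => ?_).trans (sum_mul_norm_comp_cubeEmbedding_le L F ψ)
    gcongr
    change cubeWeight t p q * _ ≤ _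
    rw [cubeWeight_conj (s := s) (u := u), eLpNorm_congr_ae (hφ q)]
    gcongr
    exact hfn q
  refine ⟨φ, hφloc, hφM, fun g => ?_⟩
  obtain ⟨J, -, hJ⟩ := exists_pairing_functional (s := s) (u := u) (w := w) hs hw hφloc.1
    (hφM.trans_lt enorm_lt_top)
  rw [← hJ]
  congr 1
  refine dual_ext hw fun q g => ?_
  rw [hJ, integral_cubeEmbedding]
  refine (hfT q g).trans (integral_congr_ae ?_)
  filter_upwards [hφ q] with x hx
  rw [hx]

end Representation

/-! ### Duality of Bourgain–Morrey spaces and block spaces -/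

section Uniqueness

variable {n : ℕ} {E : Type*} [NormedAddCommGroup E] [NormedSpace ℝ E] {p s u w : ℝ≥0∞}
  [Fact (1 ≤ p)] [Fact (1 ≤ s)] [Fact (1 ≤ w)]

theorem exists_isCompact_dyadicCube_subset (q : DyadicIndex n) :
    ∃ K : Set (EuclideanSpace ℝ (Fin n)), IsCompact K ∧ dyadicCube q ⊆ K := by
  refine ⟨(EuclideanSpace.equiv (Fin n) ℝ).toHomeomorph ⁻¹'
    Set.univ.pi fun i => Set.Icc ((2 : ℝ) ^ (-q.1) * (q.2 i : ℝ))
      ((2 : ℝ) ^ (-q.1) * ((q.2 i : ℝ) + 1)), ?_, fun x hx i _ => ⟨(hx i).1, (hx i).2.le⟩⟩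
  rw [Homeomorph.isCompact_preimage]
  exact isCompact_univ_pi fun i => isCompact_Icc

/-- A locally `p`-integrable function is determined by its pairings with the block space. -/
theorem ae_eq_of_forall_integral_eq {f f' : EuclideanSpace ℝ (Fin n) → StrongDual ℝ E}
    (hf : MemLpLoc p f) (hf' : MemLpLoc p f')
    (h : ∀ g : BlockSpace n E s u w,
      ∫ x, f x ((g : EuclideanSpace ℝ (Fin n) →ₘ[volume] E) x) =
        ∫ x, f' x ((g : EuclideanSpace ℝ (Fin n) →ₘ[volume] E) x)) : f =ᵐ[volume] f' := by
  have hint : ∀ {f : EuclideanSpace ℝ (Fin n) → StrongDual ℝ E}, MemLpLoc p f →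
      ∀ q, IntegrableOn f (dyadicCube q) volume := fun hf q => by
    obtain ⟨K, hK, hqK⟩ := exists_isCompact_dyadicCube_subset q
    exact ((hf.2 K hK).mono_measure (Measure.restrict_mono hqK le_rfl)).integrable Fact.out
  have hq : ∀ q : DyadicIndex n, ∀ᵐ x ∂volume, x ∈ dyadicCube q → f x = f' x := fun q => by
    refine (ae_restrict_iff' (measurableSet_dyadicCube q)).1 ?_
    refine ae_eq_of_forall_setIntegral_apply_eq (measurableSet_dyadicCube q) (hint hf q)
      (hint hf' q) fun A hAq hA e => ?_
    have h1 := h (cubeEmbedding s u w q (indicatorConstLp s hA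
      (measure_ne_top (volume.restrict (dyadicCube q)) _) e))
    rwa [integral_cubeEmbedding, integral_cubeEmbedding,
      integral_indicatorConstLp_apply f hA hAq, integral_indicatorConstLp_apply f' hA hAq] at h1
  filter_upwards [ae_all_iff.2 hq] with x hx
  exact hx _ (mem_dyadicCube_unitIndex x)

end Uniqueness

/-! ### Transport along an isometry onto the dual -/

section Isometry

variable {n : ℕ} {X Y : Type*} [NormedAddCommGroup X] [NormedSpace ℝ X] [NormedAddCommGroup Y]
  [NormedSpace ℝ Y] {p t r : ℝ≥0∞}

theorem morreyENorm_comp (e : X ≃ₗᵢ[ℝ] Y) (f : EuclideanSpace ℝ (Fin n) → X) :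
    morreyENorm p t r (fun x => e (f x)) = morreyENorm p t r f := by
  unfold morreyENorm
  congr 1
  funext q
  unfold morreyTerm
  rw [eLpNorm_congr_norm_ae (Eventually.of_forall fun x => e.norm_map (f x))]

theorem MemLpLoc.comp (e : X ≃ₗᵢ[ℝ] Y) {f : EuclideanSpace ℝ (Fin n) → X} (hf : MemLpLoc p f) :
    MemLpLoc p fun x => e (f x) :=
  ⟨e.continuous.comp_aestronglyMeasurable hf.1, fun K hK =>
    (hf.2 K hK).of_le (e.continuous.comp_aestronglyMeasurable hf.1.restrict)
      (Eventually.of_forall fun x => (e.norm_map (f x)).le)⟩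

end Isometry

section Duality

variable {n : ℕ} {E X : Type*} [NormedAddCommGroup E] [NormedSpace ℝ E] [NormedAddCommGroup X]
  [NormedSpace ℝ X] {p s t u r w : ℝ≥0∞}
  [Fact (1 ≤ p)] [Fact (1 ≤ s)] [Fact (1 ≤ r)] [Fact (1 ≤ w)]
  [p.HolderConjugate s] [t.HolderConjugate u] [r.HolderConjugate w]

theorem ofReal_norm_eq_morreyENorm (f : MorreySpace n X p t r) :
    ENNReal.ofReal ‖f‖ = morreyENorm p t r (f : EuclideanSpace ℝ (Fin n) → X) := by
  rw [MorreySpace.norm_def, ENNReal.ofReal_toReal f.2.2.ne]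

theorem integrable_morrey_pairing (e : X ≃ₗᵢ[ℝ] StrongDual ℝ E) (hs : s ≠ ∞) (hw : w ≠ ∞)
    (f : MorreySpace n X p t r) (g : BlockSpace n E s u w) :
    Integrable (fun x => e ((f : EuclideanSpace ℝ (Fin n) →ₘ[volume] X) x)
      ((g : EuclideanSpace ℝ (Fin n) →ₘ[volume] E) x)) volume :=
  integrable_pairing (p := p) (t := t) (r := r) hs hw (f.2.1.comp e).1
    ((morreyENorm_comp e _).trans_lt f.2.2) g

/-- The Bourgain–Morrey space is the dual of the block space. -/
theorem exists_dual_linearIsometryEquiv (e : X ≃ₗᵢ[ℝ] StrongDual ℝ E)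
    (hE : IsReflexiveSpace E ∨ TopologicalSpace.SeparableSpace (StrongDual ℝ E))
    (hp : p ≠ ∞) (hs : s ≠ ∞) (hw : w ≠ ∞) :
    ∃ J : MorreySpace n X p t r ≃ₗᵢ[ℝ] StrongDual ℝ (BlockSpace n E s u w),
      ∀ (f : MorreySpace n X p t r) (g : BlockSpace n E s u w),
        J f g = ∫ x, e ((f : EuclideanSpace ℝ (Fin n) →ₘ[volume] X) x)
          ((g : EuclideanSpace ℝ (Fin n) →ₘ[volume] E) x) := by
  choose J hJle hJ using fun f : MorreySpace n X p t r =>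
    exists_pairing_functional (s := s) (u := u) (w := w) hs hw (f.2.1.comp e).1
      ((morreyENorm_comp (t := t) (r := r) e _).trans_lt f.2.2)
  have huniq : ∀ (f : MorreySpace n X p t r) {φ : EuclideanSpace ℝ (Fin n) → StrongDual ℝ E},
      MemLpLoc p φ → (∀ g : BlockSpace n E s u w,
        J f g = ∫ x, φ x ((g : EuclideanSpace ℝ (Fin n) →ₘ[volume] E) x)) →
      (fun x => e ((f : EuclideanSpace ℝ (Fin n) →ₘ[volume] X) x)) =ᵐ[volume] φ :=
    fun f φ hφ h => ae_eq_of_forall_integral_eq (f.2.1.comp e) hφ fun g => by rw [← hJ, h]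
  have hnorm : ∀ f, ‖J f‖ = ‖f‖ := fun f => by
    refine le_antisymm ((hJle f).trans_eq (by rw [morreyENorm_comp, MorreySpace.norm_def])) ?_
    -- The function representing `J f` has Morrey norm at most `‖J f‖`, and by uniqueness it is `f`
    -- itself, read in the dual of `E`.
    obtain ⟨φ, hφ, hφM, hφJ⟩ := exists_morrey_representation (t := t) (r := r) hE hp hs hw (J f)
    rw [← morreyENorm_congr (huniq f hφ hφJ), morreyENorm_comp, ← ofReal_norm_eq_morreyENorm,
      ← ofReal_norm] at hφM
    exact (ENNReal.ofReal_le_ofReal_iff (norm_nonneg _)).1 hφM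
  let JL : MorreySpace n X p t r →ₗ[ℝ] StrongDual ℝ (BlockSpace n E s u w) :=
    { toFun := J
      map_add' := fun f f' => by
        ext g
        rw [add_apply, hJ, hJ, hJ, ← integral_add (integrable_morrey_pairing e hs hw f g)
          (integrable_morrey_pairing e hs hw f' g)]
        refine integral_congr_ae ?_
        filter_upwards [AEEqFun.coeFn_add (f : EuclideanSpace ℝ (Fin n) →ₘ[volume] X) f'] with x hx
        rw [Submodule.coe_add, hx, Pi.add_apply, map_add, add_apply]
      map_smul' := fun c f => by
        ext g
        rw [RingHom.id_apply, smul_apply, hJ, hJ, ← integral_smul]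
        refine integral_congr_ae ?_
        filter_upwards [AEEqFun.coeFn_smul c (f : EuclideanSpace ℝ (Fin n) →ₘ[volume] X)] with x hx
        rw [Submodule.coe_smul, hx, Pi.smul_apply, map_smul, smul_apply] }
  have hinj : Function.Injective JL := by
    refine (injective_iff_map_eq_zero JL).2 fun f hf => ?_
    have hf' : J f = 0 := hf
    have h := huniq f (φ := fun _ => 0) ⟨aestronglyMeasurable_const, fun K _ => MemLp.zero⟩
      fun g => by rw [hf']; simp
    refine Subtype.ext (AEEqFun.ext ?_)
    filter_upwards [h, AEEqFun.coeFn_zero (β := X)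
      (μ := (volume : Measure (EuclideanSpace ℝ (Fin n))))] with x hx h0
    rw [Submodule.coe_zero, h0]
    exact (map_eq_zero_iff e e.injective).1 hx
  have hsurj : Function.Surjective JL := fun L => by
    obtain ⟨φ, hφ, hφM, hφL⟩ := exists_morrey_representation (t := t) (r := r) hE hp hs hw L
    have hloc := hφ.comp e.symm
    have hmk := AEEqFun.coeFn_mk (fun x => e.symm (φ x)) hloc.1
    refine ⟨⟨AEEqFun.mk (fun x => e.symm (φ x)) hloc.1, hloc.congr hmk.symm, ?_⟩, ?_⟩
    · rw [morreyENorm_congr hmk, morreyENorm_comp]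
      exact hφM.trans_lt enorm_lt_top
    · ext g
      change J _ g = _
      rw [hJ, hφL]
      refine integral_congr_ae ?_
      filter_upwards [hmk] with x hx
      rw [hx, e.apply_symm_apply]
  exact ⟨⟨LinearEquiv.ofBijective JL ⟨hinj, hsurj⟩, hnorm⟩, hJ⟩

end Duality

theorem conjExponent_ne_top {q : ℝ≥0∞} (hq : 1 < q) : q.conjExponent ≠ ∞ := by
  unfold ENNReal.conjExponent
  exact ENNReal.add_ne_top.2 ⟨ENNReal.one_ne_top,
    ENNReal.inv_ne_top.2 (tsub_pos_of_lt hq).ne'⟩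

end BourgainMorrey

theorem mainTheorem1 {n : ℕ} (hn : 0 < n)
    {E X : Type*} [NormedAddCommGroup E] [NormedSpace ℝ E] [CompleteSpace E]
    [NormedAddCommGroup X] [NormedSpace ℝ X] (e : X ≃ₗᵢ[ℝ] StrongDual ℝ E)
    (hEX : BourgainMorrey.IsReflexiveSpace E ∨ TopologicalSpace.SeparableSpace X)
    {p t r : ℝ≥0∞} [Fact (1 ≤ p)] [Fact (1 ≤ r)] (hp : 1 < p)
    (hptr : (p < t ∧ t < r ∧ r < ∞) ∨ (p ≤ t ∧ t < r ∧ r = ∞)) :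
    (∃ J : BourgainMorrey.MorreySpace n X p t r ≃ₗᵢ[ℝ]
        StrongDual ℝ (BourgainMorrey.BlockSpace n E p.conjExponent t.conjExponent r.conjExponent),
      ∀ (f : BourgainMorrey.MorreySpace n X p t r)
        (g : BourgainMorrey.BlockSpace n E p.conjExponent t.conjExponent r.conjExponent),
        Integrable (fun x => e ((f : EuclideanSpace ℝ (Fin n) →ₘ[volume] X) x)
          ((g : EuclideanSpace ℝ (Fin n) →ₘ[volume] E) x)) volume ∧
        J f g = ∫ x, e ((f : EuclideanSpace ℝ (Fin n) →ₘ[volume] X) x)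
          ((g : EuclideanSpace ℝ (Fin n) →ₘ[volume] E) x)) ∧
    ∀ g : BourgainMorrey.BlockSpace n E p.conjExponent t.conjExponent r.conjExponent,
      IsGreatest
        {c : ℝ | ∃ f : BourgainMorrey.MorreySpace n X p t r, ‖f‖ ≤ 1 ∧
          c = |∫ x, e ((f : EuclideanSpace ℝ (Fin n) →ₘ[volume] X) x)
            ((g : EuclideanSpace ℝ (Fin n) →ₘ[volume] E) x)|}
        ‖g‖ := by
  have hpt : p ≤ t := hptr.elim (fun h => h.1.le) fun h => h.1
  have htr : t < r := hptr.elim (fun h => h.2.1) fun h => h.2.1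
  have : Fact (1 ≤ t) := ⟨hp.le.trans hpt⟩
  have hs := BourgainMorrey.conjExponent_ne_top hp
  have hw := BourgainMorrey.conjExponent_ne_top (hp.trans (hpt.trans_lt htr))
  have hE : BourgainMorrey.IsReflexiveSpace E ∨
      TopologicalSpace.SeparableSpace (StrongDual ℝ E) :=
    hEX.imp_right fun h => by
      have := h
      exact e.surjective.denseRange.separableSpace e.continuous
  obtain ⟨J, hJ⟩ := BourgainMorrey.exists_dual_linearIsometryEquiv (n := n) (p := p) (t := t)
    (r := r) (u := t.conjExponent) e hE (hpt.trans_lt (htr.trans_le le_top)).ne hs hw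
  refine ⟨⟨J, fun f g => ⟨BourgainMorrey.integrable_morrey_pairing e hs hw f g, hJ f g⟩⟩,
    fun g => ⟨?_, ?_⟩⟩
  -- A Hahn–Banach functional norming `g` attains the maximum, since it comes from some `f` of the
  -- same norm.
  · obtain ⟨L, hL, hLg⟩ := exists_dual_vector'' ℝ g
    refine ⟨J.symm L, by rwa [J.symm.norm_map], ?_⟩
    rw [← hJ, J.apply_symm_apply, hLg]
    simp
  · rintro c ⟨f, hf, rfl⟩
    rw [← hJ, ← Real.norm_eq_abs]
    calc ‖J f g‖ ≤ ‖J f‖ * ‖g‖ := (J f).le_opNorm g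
      _ ≤ 1 * ‖g‖ := by
        gcongr
        rwa [J.norm_map]
      _ = ‖g‖ := one_mul _
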